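/- Let $n\ge 1$ and let $\{K_t\}_{t\in[0,T)}$ be a family of smooth, strictly convex bodies in $\mathbb{R}^n$ (compact convex sets with non-empty interior whose boundary is a smooth hypersurface with positive definite second fundamental form), each with the origin in its interior. For a smooth function $f$ on $\mathbb{S}^{n-1}$ let $\bar\nabla$ denote the Levi-Civita connection (and the gradient) of the standard metric $\bar g$ of $\mathbb{S}^{n-1}$, and put $$\sigma_{n-1}[f]=\frac{\det\left(\bar\nabla_i\bar\nabla_j f+\bar g_{ij}f\right)}{\det \bar g_{ij}}.$$ Suppose that the support functions $s(z,t)=\max_{y\in K_t}\langle z,y\rangle$ are smooth on $\mathbb{S}^{n-1}\times[0,T)$ and solve the Gauss curvature flow in support-function form, $$\partial_t s=-\frac{1}{\sigma_{n-1}[s]}\quad\text{on }\mathbb{S}^{n-1}\times[0,T).$$ Then the polar bodies $K_t^*=\{x\in\mathbb{R}^n:\langle x,y\rangle\le 1\text{ for all }y\in K_t\}$, $t\in[0,T)$, are smooth, strictly convex bodies with the origin in their interiors, their support functions $s^*(z,t)=\max_{y\in K_t^*}\langle z,y\rangle$ are smooth on $\mathbb{S}^{n-1}\times[0,T)$, and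 $$\partial_t s^*=\frac{(s^*)^{n+2}\,\sigma_{n-1}[s^*]}{\left((s^*)^2+\|\bar\nabla s^*\|_{\bar g}^2\right)^{n/2}}\quad\text{on }\mathbb{S}^{n-1}\times[0,T).$$ (At $t=0$ time derivatives are one-sided.) -/

import Mathlib

open scoped ContDiff RealInnerProductSpace

noncomputable section

namespace GaussFlow

/-- Euclidean space `ℝⁿ`. -/
abbrev E (n : ℕ) : Type := EuclideanSpace ℝ (Fin n)

/-- The support function `s_K(z) = sup_{y ∈ K} ⟨z, y⟩` (used at unit vectors `z`). -/
def supp {n : ℕ} (K : Set (E n)) (z : E n) : ℝ :=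
  sSup ((fun y : E n => ⟪z, y⟫) '' K)

/-- The polar body `K* = {x : ⟨x, y⟩ ≤ 1 for all y ∈ K}`. -/
def polarBody {n : ℕ} (K : Set (E n)) : Set (E n) :=
  {x | ∀ y ∈ K, ⟪x, y⟫ ≤ 1}

/-- A smooth, strictly convex body: compact, convex, with non-empty interior, whose boundary is a
smooth hypersurface with positive definite second fundamental form. Near each boundary point `x`
the body is `{ρ ≤ 0}` for a smooth `ρ` with `dρ ≠ 0`, and the second fundamental form at `x`, for
the outer normal, is the restriction of `D²ρ(x) / |dρ(x)|` to the tangent space `ker dρ(x)`. -/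
structure IsSmoothStrictlyConvexBody {n : ℕ} (K : Set (E n)) : Prop where
  isCompact : IsCompact K
  convex : Convex ℝ K
  nonempty_interior : (interior K).Nonempty
  smooth_boundary : ∀ x ∈ frontier K, ∃ (U : Set (E n)) (ρ : E n → ℝ),
    IsOpen U ∧ x ∈ U ∧ ContDiffOn ℝ ∞ ρ U ∧ K ∩ U = {y ∈ U | ρ y ≤ 0} ∧
    fderiv ℝ ρ x ≠ 0 ∧
    ∀ v : E n, v ≠ 0 → fderiv ℝ ρ x v = 0 → 0 < fderiv ℝ (fderiv ℝ ρ) x v v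

/-- The extension `x ↦ f (x / |x|)` to `ℝⁿ \ {0}` of a function on the unit sphere; only the values
of `f` on the sphere enter. A function on the sphere is smooth iff this extension is smooth on
`ℝⁿ \ {0}`, and derivatives of `f` in tangent directions are those of the extension. -/
def radialExt {n : ℕ} {F : Type*} (f : E n → F) (x : E n) : F :=
  f (‖x‖⁻¹ • x)

/-- The gradient on the unit sphere, as a vector of `ℝⁿ` tangent to the sphere at `z`. -/
def sphGrad {n : ℕ} (f : E n → ℝ) (z : E n) : E n :=
  gradient (radialExt f) z

/-- The tangent space `z^⊥` of the unit sphere at `z`. -/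
abbrev tangent {n : ℕ} (z : E n) : Submodule ℝ (E n) := (ℝ ∙ z)ᗮ

/-- The Levi-Civita connection of the unit sphere: for a tangent vector field `Y`, the covariant
derivative of `Y` at `z` in the tangent direction `v` is the tangential part of `D_v Y`. -/
def covDeriv {n : ℕ} (Y : E n → E n) (z : E n) : tangent z →ₗ[ℝ] tangent z :=
  ((tangent z).orthogonalProjectionOnto ∘L fderiv ℝ (radialExt Y) z ∘L (tangent z).subtypeL :
    tangent z →L[ℝ] tangent z)

/-- The tensor `𝔯 = ∇̄²f + f ḡ` at `z`, with one index raised by the metric `ḡ`, that is, the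
endomorphism `v ↦ ∇̄_v (∇̄f) + f v` of the tangent space of the sphere. -/
def curvOp {n : ℕ} (f : E n → ℝ) (z : E n) : tangent z →ₗ[ℝ] tangent z :=
  covDeriv (sphGrad f) z + f z • LinearMap.id

/-- `σ_{n-1} = det (∇̄_i ∇̄_j f + ḡ_ij f) / det ḡ_ij`. -/
def sigma {n : ℕ} (f : E n → ℝ) (z : E n) : ℝ :=
  LinearMap.det (curvOp f z)

/-- The bodies `K t`, `t ∈ [0, T)`, form a smooth family of smooth, strictly convex bodies with the
origin in their interiors, whose support functions `s(z, t)` are smooth on `S^{n-1} × [0, T)` and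
satisfy `∂_t s = speed s` there (the time derivative at `t = 0` is one-sided). -/
structure EvolvesBy {n : ℕ} (speed : (E n → ℝ) → E n → ℝ) (T : ℝ) (K : ℝ → Set (E n)) : Prop where
  body : ∀ t ∈ Set.Ico 0 T, IsSmoothStrictlyConvexBody (K t)
  zero_mem : ∀ t ∈ Set.Ico 0 T, 0 ∈ interior (K t)
  smooth : ContDiffOn ℝ ∞ (fun p : E n × ℝ => radialExt (supp (K p.2)) p.1)
    ({0}ᶜ ×ˢ Set.Ico 0 T)
  evolution : ∀ t ∈ Set.Ico 0 T, ∀ z ∈ Metric.sphere (0 : E n) 1,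
    HasDerivWithinAt (fun τ => supp (K τ) z) (speed (supp (K t)) z) (Set.Ico 0 T) t

end GaussFlow

end

/-! Extend the support function s of K one-homogeneously and put D = s ∇s = ∇(s²/2) (`dualityMap`).
This is Legendre duality: D maps ℝⁿ \ {0} bijectively to itself, its inverse is the map D* of the
polar body, and s*(D(y)) = s(y). Everything is compared at dual points z = D(y) with |z| = 1.

Curvature: DD and DD* are inverse matrices, and at a unit vector the Jacobian of F ∇F is F^(n+1)
σ[F] (`det_fderiv_smul_gradient`). Since DD is 0-homogeneous, (s(y)/|y|)^(n+1) σ[s](y/|y|) ·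
s(y)^(n+1) σ[s*](z) = 1 (`sigma_mul_sigma_polarBody`). Gradient: ∇s*(z) = y/s(y), so (s*)² + ‖∇̄s*‖²
= (|y|/s(y))² (`norm_sq_sphGrad_supp_polarBody`). Time: ∂ₜs*(z) = -∂ₜs(y) = |y| / σ[s](y/|y|)
(`hasDerivWithinAt_supp_polarBody`). Eliminating σ[s] and |y| gives the equation.

Regularity: K* = {s ≤ 1}, so s - 1 is a defining function of K*; its Hessian is positive on tangent
vectors because the Hessian of s degenerates only radially (`inner_fderiv_gradient_supp_pos`). Joint
smoothness of s* follows from smoothness of the inverse of (x, t) ↦ (D_t(x), t), up to the boundary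
time t = 0 (`contDiffOn_of_rightInvOn`). -/

noncomputable section

namespace GaussFlow

open Set Filter Topology
open scoped Pointwise ContDiff RealInnerProductSpace

/-! ### Support functions and their gradients -/

section SupportFunction

variable {n : ℕ} {K : Set (E n)}

theorem bddAbove_inner_image (hK : IsCompact K) (z : E n) :
    BddAbove ((fun y : E n => ⟪z, y⟫) '' K) :=
  (hK.image (by fun_prop)).bddAbove

theorem inner_le_supp (hK : IsCompact K) (z : E n) {y : E n} (hy : y ∈ K) : ⟪z, y⟫ ≤ supp K z :=
  le_csSup (bddAbove_inner_image hK z) (mem_image_of_mem _ hy)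

theorem exists_inner_eq_supp (hK : IsCompact K) (hne : K.Nonempty) (z : E n) :
    ∃ y ∈ K, ⟪z, y⟫ = supp K z :=
  (hK.image (f := fun y : E n => ⟪z, y⟫) (by fun_prop)).sSup_mem (hne.image _)

theorem supp_smul (K : Set (E n)) {c : ℝ} (hc : 0 ≤ c) (z : E n) :
    supp K (c • z) = c * supp K z := by
  have : (fun y : E n => ⟪c • z, y⟫) '' K = c • ((fun y : E n => ⟪z, y⟫) '' K) := by
    rw [← image_smul, image_image]
    simp [real_inner_smul_left]
  rw [supp, this, Real.sSup_smul_of_nonneg hc]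
  rfl

theorem supp_pos (hK : IsCompact K) (h0 : 0 ∈ interior K) {z : E n} (hz : z ≠ 0) :
    0 < supp K z := by
  have hcont : Tendsto (fun r : ℝ => r • z) (𝓝[>] 0) (𝓝 0) := by
    have : Continuous fun r : ℝ => r • z := by fun_prop
    simpa using (this.tendsto 0).mono_left nhdsWithin_le_nhds
  obtain ⟨r, hr, hr0⟩ := ((hcont.eventually (mem_interior_iff_mem_nhds.1 h0)).and
    self_mem_nhdsWithin).exists
  have h1 := inner_le_supp hK z hr
  rw [real_inner_smul_right] at h1
  have h2 : 0 < r * ⟪z, z⟫ := mul_pos hr0 (real_inner_self_pos.2 hz)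
  linarith

theorem mem_polarBody_iff (hK : IsCompact K) (hne : K.Nonempty) {x : E n} :
    x ∈ polarBody K ↔ supp K x ≤ 1 := by
  constructor
  · intro h
    obtain ⟨y, hy, hxy⟩ := exists_inner_eq_supp hK hne x
    exact hxy ▸ h y hy
  · exact fun h y hy => (inner_le_supp hK x hy).trans h

/-- The function `supp K - ⟪y, ·⟫` is nonnegative and vanishes at `z`, so its derivative there is
zero. Hence the gradient is the supporting point. -/
theorem fderiv_supp_apply (hK : IsCompact K) {z y : E n} (hy : y ∈ K) (hzy : ⟪z, y⟫ = supp K z)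
    (hd : DifferentiableAt ℝ (supp K) z) (v : E n) : fderiv ℝ (supp K) z v = ⟪y, v⟫ := by
  have hmin : IsLocalMin (fun x => supp K x - ⟪y, x⟫) z := by
    refine Eventually.of_forall fun x => ?_
    have := inner_le_supp hK x hy
    have h2 := real_inner_comm y x
    have h3 := real_inner_comm y z
    simp only
    linarith
  have hfd : HasFDerivAt (fun x => supp K x - ⟪y, x⟫) (fderiv ℝ (supp K) z - innerSL ℝ y) z :=
    hd.hasFDerivAt.sub (innerSL ℝ y).hasFDerivAt
  have := congrArg (fun L => L v) (hmin.hasFDerivAt_eq_zero hfd)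
  simpa [sub_eq_zero] using this

theorem gradient_supp_eq (hK : IsCompact K) {z y : E n} (hy : y ∈ K) (hzy : ⟪z, y⟫ = supp K z)
    (hd : DifferentiableAt ℝ (supp K) z) : gradient (supp K) z = y := by
  refine ext_inner_right ℝ fun v => ?_
  rw [inner_gradient_left, fderiv_supp_apply hK hy hzy hd]

theorem gradient_supp_mem (hK : IsCompact K) (hne : K.Nonempty) {z : E n}
    (hd : DifferentiableAt ℝ (supp K) z) : gradient (supp K) z ∈ K := by
  obtain ⟨y, hy, hzy⟩ := exists_inner_eq_supp hK hne z
  rwa [gradient_supp_eq hK hy hzy hd]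

theorem inner_gradient_supp (hK : IsCompact K) (hne : K.Nonempty) {z : E n}
    (hd : DifferentiableAt ℝ (supp K) z) : ⟪z, gradient (supp K) z⟫ = supp K z := by
  obtain ⟨y, hy, hzy⟩ := exists_inner_eq_supp hK hne z
  rw [gradient_supp_eq hK hy hzy hd, hzy]

end SupportFunction

/-! ### Elementary properties of the polar body -/

section Polar

variable {n : ℕ} {K : Set (E n)}

theorem isClosed_polarBody (K : Set (E n)) : IsClosed (polarBody K) := by
  have : polarBody K = ⋂ y ∈ K, {x | ⟪x, y⟫ ≤ 1} := by ext; simp [polarBody]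
  rw [this]
  exact isClosed_biInter fun y _ => isClosed_le (by fun_prop) continuous_const

theorem convex_polarBody (K : Set (E n)) : Convex ℝ (polarBody K) := by
  intro x hx y hy a b ha hb hab w hw
  rw [inner_add_left, real_inner_smul_left, real_inner_smul_left]
  nlinarith [hx w hw, hy w hw]

theorem isCompact_polarBody (h0 : 0 ∈ interior K) : IsCompact (polarBody K) := by
  refine Metric.isCompact_of_isClosed_isBounded (isClosed_polarBody K) ?_
  obtain ⟨r, hr, hrK⟩ := Metric.nhds_basis_closedBall.mem_iff.1 (mem_interior_iff_mem_nhds.1 h0)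
  refine (Metric.isBounded_closedBall (x := (0 : E n)) (r := r⁻¹)).subset fun x hx => ?_
  rw [mem_closedBall_zero_iff]
  rcases eq_or_ne x 0 with rfl | hx0
  · simp [hr.le]
  have hn : 0 < ‖x‖ := norm_pos_iff.2 hx0
  have := hx ((r * ‖x‖⁻¹) • x) (hrK (by
    rw [mem_closedBall_zero_iff, norm_smul, Real.norm_of_nonneg (by positivity), mul_assoc,
      inv_mul_cancel₀ hn.ne', mul_one]))
  rw [real_inner_smul_right, real_inner_self_eq_norm_sq] at this
  rw [← one_div, le_div_iff₀ hr]
  calc ‖x‖ * r = r * ‖x‖⁻¹ * ‖x‖ ^ 2 := by field_simp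
    _ ≤ 1 := this

theorem zero_mem_interior_polarBody (hK : IsCompact K) : 0 ∈ interior (polarBody K) := by
  obtain ⟨R, hR, hKR⟩ := hK.isBounded.exists_pos_norm_le
  rw [mem_interior_iff_mem_nhds]
  refine mem_of_superset (Metric.ball_mem_nhds 0 (inv_pos.2 hR)) fun x hx y hy => ?_
  rw [mem_ball_zero_iff] at hx
  calc ⟪x, y⟫ ≤ ‖x‖ * ‖y‖ := real_inner_le_norm x y
    _ ≤ R⁻¹ * R := by gcongr; exact hKR y hy
    _ = 1 := inv_mul_cancel₀ hR.ne'

end Polar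

/-! ### Euler relations for one-homogeneous functions -/

section Homogeneous

variable {n : ℕ} {F : E n → ℝ}

theorem contDiffAt_of_ne_zero {G : Type*} [NormedAddCommGroup G] [NormedSpace ℝ G] {f : E n → G}
    (hs : ContDiffOn ℝ ∞ f {0}ᶜ) {x : E n} (hx : x ≠ 0) : ContDiffAt ℝ ∞ f x :=
  hs.contDiffAt (isOpen_compl_singleton.mem_nhds hx)

theorem contDiffAt_gradient {f : E n → ℝ} {x : E n} (hf : ContDiffAt ℝ ∞ f x) :
    ContDiffAt ℝ ∞ (gradient f) x :=
  (InnerProductSpace.toDual ℝ (E n)).symm.contDiff.contDiffAt.comp x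
    (hf.fderiv_right (m := ∞) (by norm_cast))

theorem inner_fderiv_gradient {f : E n → ℝ} {x : E n} (hf : ContDiffAt ℝ ∞ f x) (v w : E n) :
    ⟪fderiv ℝ (gradient f) x v, w⟫ = fderiv ℝ (fderiv ℝ f) x v w := by
  have hd : DifferentiableAt ℝ (fderiv ℝ f) x :=
    (hf.fderiv_right (m := ∞) (by norm_cast)).differentiableAt (by simp)
  have h : HasFDerivAt (gradient f) _ x :=
    ((InnerProductSpace.toDual ℝ (E n)).symm.toContinuousLinearEquiv.hasFDerivAt).comp x
      hd.hasFDerivAt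
  rw [h.fderiv]
  simp

theorem inner_fderiv_gradient_comm {f : E n → ℝ} {x : E n} (hf : ContDiffAt ℝ ∞ f x) (v w : E n) :
    ⟪fderiv ℝ (gradient f) x v, w⟫ = ⟪fderiv ℝ (gradient f) x w, v⟫ := by
  rw [inner_fderiv_gradient hf, inner_fderiv_gradient hf]
  exact hf.isSymmSndFDerivAt (by simp; norm_cast) v w

theorem gradient_smul_of_homogeneous (hF : ∀ c : ℝ, 0 < c → ∀ x, F (c • x) = c * F x)
    {c : ℝ} (hc : 0 < c) (x : E n) :
    gradient F (c • x) = gradient F x := by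
  have h1 : fderiv ℝ (fun y => F (c • y)) x = c • fderiv ℝ F (c • x) := fderiv_comp_smul c
  have h2 : (fun y => F (c • y)) = c • F := funext fun y => by simp [hF c hc]
  rw [h2, fderiv_const_smul_field] at h1
  have h3 := smul_right_injective _ hc.ne' h1
  simp only [gradient]
  rw [h3]

theorem inner_gradient_self_of_homogeneous (hF : ∀ c : ℝ, 0 < c → ∀ x, F (c • x) = c * F x)
    {x : E n} (hd : DifferentiableAt ℝ F x) :
    ⟪gradient F x, x⟫ = F x := by
  rw [inner_gradient_left]
  have h1 : HasDerivAt (fun c : ℝ => c • x) x 1 := by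
    simpa using (hasDerivAt_id (1 : ℝ)).smul_const x
  have h2 : HasDerivAt (fun c : ℝ => F (c • x)) (fderiv ℝ F x x) 1 := by
    have hd' : HasFDerivAt F (fderiv ℝ F x) ((1 : ℝ) • x) := by simpa using hd.hasFDerivAt
    exact hd'.comp_hasDerivAt 1 h1
  have h3 : HasDerivAt (fun c : ℝ => F (c • x)) (F x) 1 := by
    have : HasDerivAt (fun c : ℝ => c * F x) (F x) 1 := by
      simpa using (hasDerivAt_id (1 : ℝ)).mul_const (F x)
    refine this.congr_of_eventuallyEq ?_
    filter_upwards [lt_mem_nhds one_pos] with c hc using hF c hc x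
  exact h2.unique h3

theorem fderiv_gradient_self_of_homogeneous (hF : ∀ c : ℝ, 0 < c → ∀ x, F (c • x) = c * F x)
    {x : E n} (hd : DifferentiableAt ℝ (gradient F) x) :
    fderiv ℝ (gradient F) x x = 0 := by
  have h1 : HasDerivAt (fun c : ℝ => c • x) x 1 := by
    simpa using (hasDerivAt_id (1 : ℝ)).smul_const x
  have h2 : HasDerivAt (fun c : ℝ => gradient F (c • x)) (fderiv ℝ (gradient F) x x) 1 := by
    have hd' : HasFDerivAt (gradient F) (fderiv ℝ (gradient F) x) ((1 : ℝ) • x) := by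
      simpa using hd.hasFDerivAt
    exact hd'.comp_hasDerivAt 1 h1
  have h3 : HasDerivAt (fun c : ℝ => gradient F (c • x)) 0 1 := by
    refine (hasDerivAt_const (1 : ℝ) (gradient F x)).congr_of_eventuallyEq ?_
    filter_upwards [lt_mem_nhds one_pos] with c hc using gradient_smul_of_homogeneous hF hc x
  exact h2.unique h3

end Homogeneous

/-! ### Outer normals, the Hessian of the support function, regularity of the polar body -/

section Normals

variable {n : ℕ} {K : Set (E n)}

theorem mem_frontier_of_isMaxOn {x y : E n} (hx : x ≠ 0) (hy : y ∈ K)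
    (hmax : ∀ k ∈ K, ⟪x, k⟫ ≤ ⟪x, y⟫) : y ∈ frontier K := by
  refine ⟨subset_closure hy, fun hint => ?_⟩
  have hcont : Tendsto (fun r : ℝ => y + r • x) (𝓝[>] 0) (𝓝 y) := by
    have : Continuous fun r : ℝ => y + r • x := by fun_prop
    simpa using (this.tendsto 0).mono_left nhdsWithin_le_nhds
  obtain ⟨r, hr, hr0⟩ := ((hcont.eventually (mem_interior_iff_mem_nhds.1 hint)).and
    self_mem_nhdsWithin).exists
  have h1 := hmax _ hr
  rw [inner_add_right, real_inner_smul_right] at h1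
  have h2 : 0 < r * ⟪x, x⟫ := mul_pos hr0 (real_inner_self_pos.2 hx)
  linarith

/-- A linear functional attaining its maximum over `K = {ρ ≤ 0}` at `y` is a nonnegative multiple
of `∇ρ(y)`. -/
theorem exists_eq_smul_gradient {U : Set (E n)} {ρ : E n → ℝ} (hU : IsOpen U)
    (hKU : K ∩ U = {y ∈ U | ρ y ≤ 0}) {x y : E n} (hyU : y ∈ U) (hρ : DifferentiableAt ℝ ρ y)
    (hρ0 : fderiv ℝ ρ y ≠ 0) (hy : y ∈ K) (hmax : ∀ k ∈ K, ⟪x, k⟫ ≤ ⟪x, y⟫) :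
    ∃ c : ℝ, 0 ≤ c ∧ x = c • gradient ρ y := by
  -- A direction of strict descent of `ρ` enters `K`, so the functional cannot increase along it.
  have key : ∀ u, ⟪gradient ρ y, u⟫ < 0 → ⟪x, u⟫ ≤ 0 := by
    intro u hu
    rw [inner_gradient_left] at hu
    have hρy : ρ y ≤ 0 := by
      have : y ∈ {y ∈ U | ρ y ≤ 0} := hKU ▸ ⟨hy, hyU⟩
      exact this.2
    have h1 : HasDerivAt (fun r : ℝ => y + r • u) u 0 := by
      simpa using ((hasDerivAt_id (0 : ℝ)).smul_const u).const_add y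
    have hd' : HasFDerivAt ρ (fderiv ℝ ρ y) (y + (0 : ℝ) • u) := by simpa using hρ.hasFDerivAt
    have h2 : HasDerivAt (fun r : ℝ => ρ (y + r • u)) (fderiv ℝ ρ y u) 0 :=
      hd'.comp_hasDerivAt 0 h1
    have h3 : ∀ᶠ r : ℝ in 𝓝[>] 0, ρ (y + r • u) < ρ y := by
      have h4 := ((hasDerivWithinAt_iff_tendsto_slope' (by simp)).1
        (h2.hasDerivWithinAt (s := Ioi 0))).eventually (gt_mem_nhds hu)
      filter_upwards [h4, self_mem_nhdsWithin] with r hr hr0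
      rw [slope_def_field, sub_zero] at hr
      simp only [zero_smul, add_zero] at hr
      have := (div_neg_iff.1 hr)
      rcases this with h | h
      · exact absurd h.2 (not_lt.2 (le_of_lt hr0))
      · linarith [h.1]
    have hcont : Tendsto (fun r : ℝ => y + r • u) (𝓝[>] 0) (𝓝 y) := by
      have : Continuous fun r : ℝ => y + r • u := by fun_prop
      simpa using (this.tendsto 0).mono_left nhdsWithin_le_nhds
    obtain ⟨r, ⟨hr, hrU⟩, hr0⟩ := ((h3.and (hcont.eventually (hU.mem_nhds hyU))).and
      self_mem_nhdsWithin).exists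
    have hmem : y + r • u ∈ K ∩ U := by
      rw [hKU]
      exact ⟨hrU, by linarith⟩
    have := hmax _ hmem.1
    rw [inner_add_right, real_inner_smul_right] at this
    by_contra hcon
    have := mul_pos hr0 (not_le.1 hcon)
    linarith
  set p := gradient ρ y with hp
  have hp0 : p ≠ 0 := by
    intro h
    apply hρ0
    rw [← toDual_gradient, ← hp, h, map_zero]
  have hpp : 0 < ⟪p, p⟫ := real_inner_self_pos.2 hp0
  -- The part of `x` orthogonal to `p`. It is only a limit of descent directions `u - ε • p`;
  -- testing these and letting ε → 0 gives |u|² ≤ 0.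
  set u := x - (⟪p, x⟫ / ⟪p, p⟫) • p with hu
  have hpu : ⟪p, u⟫ = 0 := by
    rw [hu, inner_sub_right, real_inner_smul_right]
    field_simp
    ring
  have hxu : ⟪x, u⟫ = ⟪u, u⟫ := by
    have : x = u + (⟪p, x⟫ / ⟪p, p⟫) • p := by rw [hu]; abel
    conv_lhs => rw [this]
    rw [inner_add_left, real_inner_smul_left, hpu]
    ring
  have hu0 : u = 0 := by
    have : ⟪u, u⟫ ≤ 0 := by
      have ht : Tendsto (fun ε : ℝ => ε * ⟪x, p⟫) (𝓝[>] 0) (𝓝 0) := by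
        have : Continuous fun ε : ℝ => ε * ⟪x, p⟫ := by fun_prop
        simpa using (this.tendsto 0).mono_left nhdsWithin_le_nhds
      refine ge_of_tendsto ht ?_
      filter_upwards [self_mem_nhdsWithin] with ε hε
      have := key (u - ε • p) (by
        rw [inner_sub_right, real_inner_smul_right, hpu]
        have := mul_pos (show (0 : ℝ) < ε from hε) hpp
        linarith)
      rw [inner_sub_right, real_inner_smul_right, hxu] at this
      linarith
    exact real_inner_self_nonpos.1 this
  refine ⟨⟪p, x⟫ / ⟪p, p⟫, div_nonneg ?_ hpp.le, ?_⟩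
  · have := key (-p) (by rw [inner_neg_right]; linarith)
    rw [inner_neg_right, real_inner_comm] at this
    linarith
  · rw [hu, sub_eq_zero] at hu0
    exact hu0

/-- The outer normal direction at a point of a smooth strictly convex body is unique. -/
theorem exists_eq_smul_of_isMaxOn (hK : IsSmoothStrictlyConvexBody K) {x x' y : E n} (hx : x ≠ 0)
    (hx' : x' ≠ 0) (hy : y ∈ K) (hmax : ∀ k ∈ K, ⟪x, k⟫ ≤ ⟪x, y⟫)
    (hmax' : ∀ k ∈ K, ⟪x', k⟫ ≤ ⟪x', y⟫) : ∃ c : ℝ, 0 < c ∧ x' = c • x := by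
  obtain ⟨U, ρ, hU, hyU, hρ, hKU, hρ0, -⟩ :=
    hK.smooth_boundary y (mem_frontier_of_isMaxOn hx hy hmax)
  have hd : DifferentiableAt ℝ ρ y :=
    (hρ.contDiffAt (hU.mem_nhds hyU)).differentiableAt (by simp)
  obtain ⟨c, hc, h1⟩ := exists_eq_smul_gradient hU hKU hyU hd hρ0 hy hmax
  obtain ⟨c', hc', h2⟩ := exists_eq_smul_gradient hU hKU hyU hd hρ0 hy hmax'
  have hc0 : c ≠ 0 := by rintro rfl; simp at h1; exact hx h1
  have hc0' : c' ≠ 0 := by rintro rfl; simp at h2; exact hx' h2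
  refine ⟨c' / c, div_pos (hc'.lt_of_ne hc0'.symm) (hc.lt_of_ne hc0.symm), ?_⟩
  rw [h1, h2, smul_smul, div_mul_cancel₀ _ hc0]

/-- The kernel of the Hessian of the support function at `x` is the line spanned by `x`. -/
theorem exists_eq_smul_of_fderiv_gradient_supp_eq_zero (hK : IsSmoothStrictlyConvexBody K)
    (hs : ContDiffOn ℝ ∞ (supp K) {0}ᶜ) {x v : E n} (hx : x ≠ 0)
    (hv : fderiv ℝ (gradient (supp K)) x v = 0) : ∃ c : ℝ, v = c • x := by
  have hne : K.Nonempty := hK.nonempty_interior.mono interior_subset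
  have hmem : ∀ x' : E n, x' ≠ 0 → gradient (supp K) x' ∈ K ∧
      ∀ k ∈ K, ⟪x', k⟫ ≤ ⟪x', gradient (supp K) x'⟫ := by
    intro x' hx'
    have hd := (contDiffAt_of_ne_zero hs hx').differentiableAt (by simp)
    refine ⟨gradient_supp_mem hK.isCompact hne hd, fun k hk => ?_⟩
    rw [inner_gradient_supp hK.isCompact hne hd]
    exact inner_le_supp hK.isCompact x' hk
  set G := gradient (supp K) with hG
  obtain ⟨U, ρ, hU, hyU, hρ, hKU, hρ0, -⟩ :=
    hK.smooth_boundary (G x) (mem_frontier_of_isMaxOn hx (hmem x hx).1 (hmem x hx).2)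
  have hGs : ContDiffAt ℝ ∞ G x := contDiffAt_gradient (contDiffAt_of_ne_zero hs hx)
  have hρs : ContDiffAt ℝ ∞ ρ (G x) := hρ.contDiffAt (hU.mem_nhds hyU)
  have hfc : ContinuousAt (fderiv ℝ ρ) (G x) :=
    (hρs.fderiv_right (m := ∞) (by norm_cast)).continuousAt
  have hcol : ∀ᶠ x' in 𝓝 x, ∃ c : ℝ, 0 ≤ c ∧ x' = c • gradient ρ (G x') := by
    filter_upwards [isOpen_compl_singleton.mem_nhds hx,
      hGs.continuousAt.eventually (hU.mem_nhds hyU),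
      hGs.continuousAt.eventually (hfc.eventually_ne hρ0)] with x' hx' hU' hne'
    exact exists_eq_smul_gradient hU hKU hU'
      ((hρ.contDiffAt (hU.mem_nhds hU')).differentiableAt (by simp)) hne' (hmem x' hx').1
      (hmem x' hx').2
  have hN : HasFDerivAt (fun x' => gradient ρ (G x'))
      ((fderiv ℝ (gradient ρ) (G x)).comp (fderiv ℝ G x)) x :=
    (((contDiffAt_gradient hρs).differentiableAt (by simp)).hasFDerivAt).comp x
      (hGs.differentiableAt (by simp)).hasFDerivAt
  -- The factor in x' = c N(x'), with N = ∇ρ ∘ G, has no known regularity. It is eliminated through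
  -- ⟪N, x'⟫ x' = ⟪x', x'⟫ N, which can be differentiated. Along a `v` killed by the derivative of
  -- `G`, N is stationary, so only multiples of `v`, `x` and N remain, and N is parallel to `x`.
  have hL := (hN.inner ℝ (hasFDerivAt_id x)).smul (hasFDerivAt_id x)
  have hR := ((hasFDerivAt_id x).inner ℝ (hasFDerivAt_id x)).smul hN
  have hLR := hL.unique (hR.congr_of_eventuallyEq (by
    filter_upwards [hcol] with x' ⟨c, hc, h⟩
    change ⟪gradient ρ (G x'), x'⟫ • x' = ⟪x', x'⟫ • gradient ρ (G x')
    generalize gradient ρ (G x') = N at h ⊢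
    subst h
    simp only [real_inner_smul_left, real_inner_smul_right, smul_smul]
    congr 1
    ring))
  have hLRv := congrArg (fun L => L v) hLR
  simp [hv] at hLRv
  obtain ⟨c, hc, hxc⟩ := hcol.self_of_nhds
  have hc0 : c ≠ 0 := by rintro rfl; simp at hxc; exact hx hxc
  have hNx : gradient ρ (G x) = c⁻¹ • x := by
    conv_rhs => rw [hxc]
    rw [smul_smul, inv_mul_cancel₀ hc0, one_smul]
  rw [← inner_gradient_left, ← inner_gradient_left, hNx] at hLRv
  have hxx : c⁻¹ * ⟪x, x⟫ ≠ 0 := mul_ne_zero (inv_ne_zero hc0) (real_inner_self_pos.2 hx).ne'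
  rw [real_inner_smul_left, real_inner_smul_left, ← eq_sub_iff_add_eq, smul_smul,
    ← sub_smul] at hLRv
  refine ⟨(c⁻¹ * ⟪x, x⟫)⁻¹ * ((⟪x, v⟫ + ⟪v, x⟫) * c⁻¹ - c⁻¹ * ⟪x, v⟫), ?_⟩
  rw [mul_smul, ← hLRv, smul_smul, inv_mul_cancel₀ hxx, one_smul]

/-- Monotonicity of the gradient: each of the points G(x), G(x + rv) of `K` is tested against the
functional maximised by the other, and the difference quotient passes to the limit. -/
theorem inner_fderiv_gradient_supp_nonneg (hK : IsCompact K) (hne : K.Nonempty)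
    (hs : ContDiffOn ℝ ∞ (supp K) {0}ᶜ) {x : E n} (hx : x ≠ 0) (v : E n) :
    0 ≤ ⟪fderiv ℝ (gradient (supp K)) x v, v⟫ := by
  have hd : ∀ x' : E n, x' ≠ 0 → DifferentiableAt ℝ (supp K) x' := fun x' hx' =>
    (contDiffAt_of_ne_zero hs hx').differentiableAt (by simp)
  set G := gradient (supp K) with hG
  have hGd : HasFDerivAt G (fderiv ℝ G x) (x + (0 : ℝ) • v) := by
    simpa using ((contDiffAt_gradient (contDiffAt_of_ne_zero hs hx)).differentiableAt
      (by simp)).hasFDerivAt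
  have h1 : HasDerivAt (fun r : ℝ => x + r • v) v 0 := by
    simpa using ((hasDerivAt_id (0 : ℝ)).smul_const v).const_add x
  have h2 : HasDerivAt (fun r : ℝ => ⟪G (x + r • v), v⟫) ⟪fderiv ℝ G x v, v⟫ 0 := by
    simpa using (hGd.comp_hasDerivAt 0 h1).inner ℝ (hasDerivAt_const 0 v)
  have h3 := (hasDerivWithinAt_iff_tendsto_slope' (by simp)).1 (h2.hasDerivWithinAt (s := Ioi 0))
  have hcont : Tendsto (fun r : ℝ => x + r • v) (𝓝[>] 0) (𝓝 x) := by
    have : Continuous fun r : ℝ => x + r • v := by fun_prop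
    simpa using (this.tendsto 0).mono_left nhdsWithin_le_nhds
  refine ge_of_tendsto h3 ?_
  filter_upwards [hcont.eventually (isOpen_compl_singleton.mem_nhds hx), self_mem_nhdsWithin]
    with r hr hr0
  have hr0 : 0 < r := hr0
  rw [slope_def_field, sub_zero]
  refine div_nonneg ?_ hr0.le
  have e1 := inner_gradient_supp hK hne (hd _ hr)
  have e2 := inner_gradient_supp hK hne (hd _ hx)
  have e3 := inner_le_supp hK (x + r • v) (gradient_supp_mem hK hne (hd _ hx))
  have e4 := inner_le_supp hK x (gradient_supp_mem hK hne (hd _ hr))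
  rw [← hG] at e1 e2 e3 e4
  rw [inner_add_left, real_inner_smul_left] at e1 e3
  simp only [zero_smul, add_zero]
  rw [real_inner_comm v, real_inner_comm v]
  have : 0 ≤ r * (⟪v, G (x + r • v)⟫ - ⟪v, G x⟫) := by linarith
  exact nonneg_of_mul_nonneg_right this hr0

/-- The Hessian of the support function is positive on vectors not collinear with the base point. -/
theorem inner_fderiv_gradient_supp_pos (hK : IsSmoothStrictlyConvexBody K)
    (hs : ContDiffOn ℝ ∞ (supp K) {0}ᶜ) {x : E n} (hx : x ≠ 0) {v : E n}
    (hv : ∀ c : ℝ, v ≠ c • x) : 0 < ⟪fderiv ℝ (gradient (supp K)) x v, v⟫ := by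
  have hne : K.Nonempty := hK.nonempty_interior.mono interior_subset
  refine (inner_fderiv_gradient_supp_nonneg hK.isCompact hne hs hx v).lt_of_ne fun h0 => ?_
  obtain ⟨c, hc⟩ : ∃ c : ℝ, v = c • x := by
    refine exists_eq_smul_of_fderiv_gradient_supp_eq_zero hK hs hx ?_
    set B := fderiv ℝ (gradient (supp K)) x with hB
    have hsymm := inner_fderiv_gradient_comm (contDiffAt_of_ne_zero hs hx)
    rw [← hB] at hsymm
    -- The quadratic form of `B` at `v + r • B v`. It is nonnegative with zero constant term, so the
    -- discriminant forces the linear coefficient, and with it `B v`, to vanish.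
    have hq : ∀ r : ℝ, 0 ≤ ⟪B (B v), B v⟫ * (r * r) + 2 * ⟪B v, B v⟫ * r + 0 := by
      intro r
      have := inner_fderiv_gradient_supp_nonneg hK.isCompact hne hs hx (v + r • B v)
      rw [← hB] at this
      simp only [map_add, map_smul, inner_add_left, inner_add_right, real_inner_smul_left,
        real_inner_smul_right, ← h0, hsymm (B v) v] at this
      linarith
    have hdisc := discrim_le_zero hq
    rw [discrim] at hdisc
    have : ⟪B v, B v⟫ = 0 := by nlinarith
    exact inner_self_eq_zero.1 this
  exact hv c hc

theorem isSmoothStrictlyConvexBody_polarBody (hK : IsSmoothStrictlyConvexBody K)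
    (h0 : 0 ∈ interior K) (hs : ContDiffOn ℝ ∞ (supp K) {0}ᶜ) :
    IsSmoothStrictlyConvexBody (polarBody K) where
  isCompact := isCompact_polarBody h0
  convex := convex_polarBody K
  nonempty_interior := ⟨0, zero_mem_interior_polarBody hK.isCompact⟩
  smooth_boundary := by
    intro x hx
    have hne : K.Nonempty := hK.nonempty_interior.mono interior_subset
    have hx0 : x ≠ 0 := by
      rintro rfl
      exact hx.2 (zero_mem_interior_polarBody hK.isCompact)
    have hxs := contDiffAt_of_ne_zero hs hx0
    have hself : fderiv ℝ (supp K) x x = supp K x := by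
      rw [← inner_gradient_left, inner_gradient_self_of_homogeneous
        (fun c hc y => supp_smul K hc.le y) (hxs.differentiableAt (by simp))]
    have hpos := supp_pos hK.isCompact h0 hx0
    have hfd : fderiv ℝ (fun y => supp K y - 1) = fderiv ℝ (supp K) :=
      funext fun y => fderiv_sub_const 1
    -- One global defining function serves at every boundary point. By Euler its derivative along
    -- `x` is s(x) > 0, so it is regular and no nonzero tangent vector is radial.
    refine ⟨{0}ᶜ, fun y => supp K y - 1, isOpen_compl_singleton, hx0, hs.sub contDiffOn_const,
      ?_, ?_, ?_⟩
    · ext y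
      simp only [mem_inter_iff, mem_polarBody_iff hK.isCompact hne, mem_ofPred_eq, sub_nonpos]
      exact and_comm
    · rw [hfd]
      intro h
      rw [h] at hself
      exact hpos.ne hself
    · intro v hv hdv
      rw [hfd] at hdv ⊢
      rw [← inner_fderiv_gradient hxs]
      refine inner_fderiv_gradient_supp_pos hK hs hx0 fun c hc => hv ?_
      rw [hc, map_smul, hself, smul_eq_mul] at hdv
      rw [hc, (mul_eq_zero.1 hdv).resolve_right hpos.ne', zero_smul]

end Normals

/-! ### A determinant identity for a rank-one perturbation -/

section Determinant

variable {n : ℕ}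

/-- The determinant of `u ↦ ⟨p, u⟩ p + ⟨p, z⟩ B u`, where `B` is an operator vanishing on `z` and
mapping into `z^⊥`. -/
theorem det_rank_one_add {z p : E n} (hz : ‖z‖ = 1) (hp : ⟪p, z⟫ ≠ 0) (A B : E n →ₗ[ℝ] E n)
    (hBz : B z = 0) (C : tangent z →ₗ[ℝ] tangent z) (hC : ∀ v : tangent z, (C v : E n) = B v)
    (hA : ∀ u, A u = ⟪p, u⟫ • p + ⟪p, z⟫ • B u) :
    LinearMap.det A = ⟪p, z⟫ ^ (n + 1) * LinearMap.det C := by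
  set a := ⟪p, z⟫ with ha
  have hz0 : z ≠ 0 := by rintro rfl; simp at hz
  have hzz : ⟪z, z⟫ = 1 := by rw [real_inner_self_eq_norm_sq, hz, one_pow]
  set q := a⁻¹ • p - z with hq
  have hqz : ⟪q, z⟫ = 0 := by
    rw [hq, inner_sub_left, real_inner_smul_left, ← ha, inv_mul_cancel₀ hp, hzz, sub_self]
  have hzq : ⟪z, q⟫ = 0 := by rw [real_inner_comm, hqz]
  set e := Submodule.prodEquivOfIsCompl (ℝ ∙ z) (tangent z)
    (Submodule.isCompl_orthogonal _) with he
  -- Block diagonal: a² on the line of `z` and a C on `z^⊥`, of dimension n - 1, whence the exponent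
  -- 2 + (n - 1).
  set D : E n →ₗ[ℝ] E n := e.toLinearMap ∘ₗ
    ((a ^ 2) • LinearMap.id).prodMap (a • C) ∘ₗ e.symm.toLinearMap with hD
  have hDdet : LinearMap.det D = a ^ (n + 1) * LinearMap.det C := by
    have h1 : LinearMap.det D = LinearMap.det
        (((a ^ 2) • (LinearMap.id : (ℝ ∙ z) →ₗ[ℝ] (ℝ ∙ z))).prodMap (a • C)) :=
      LinearMap.det_conj _ e
    have h2 : Module.finrank ℝ (ℝ ∙ z) + Module.finrank ℝ (tangent z) = n := by
      rw [Submodule.finrank_add_finrank_orthogonal]; simp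
    rw [finrank_span_singleton hz0] at h2
    rw [h1, LinearMap.det_prodMap, LinearMap.det_smul, LinearMap.det_smul, LinearMap.det_id,
      finrank_span_singleton hz0]
    have h3 : n + 1 = 2 + Module.finrank ℝ (tangent z) := by
      rw [← add_left_inj 1] at h2
      rw [← h2]
      exact add_right_comm 1 _ 1 |>.trans (by norm_num)
    rw [h3, pow_add]
    ring
  have hDz : D z = a ^ 2 • z := by
    have : e.symm z = (⟨z, Submodule.mem_span_singleton_self z⟩, 0) := by
      rw [LinearEquiv.symm_apply_eq]; simp [e]
    rw [hD, LinearMap.comp_apply, LinearMap.comp_apply, LinearEquiv.coe_coe, LinearEquiv.coe_coe,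
      this]
    simp [e]
  have hDt : ∀ v : tangent z, D v = a • B v := by
    intro v
    have : e.symm v = (0, v) := by
      rw [LinearEquiv.symm_apply_eq]; simp [e]
    rw [hD, LinearMap.comp_apply, LinearMap.comp_apply, LinearEquiv.coe_coe, LinearEquiv.coe_coe,
      this]
    simp [e, hC]
  have hmem : ∀ u, u - ⟪z, u⟫ • z ∈ tangent z := fun u => by
    rw [Submodule.mem_orthogonal_singleton_iff_inner_right, inner_sub_right,
      real_inner_smul_right, hzz, mul_one, sub_self]
  have hzB : ∀ w, ⟪z, B w⟫ = 0 := fun w => by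
    have h := (C ⟨_, hmem w⟩).2
    rw [hC, Submodule.mem_orthogonal_singleton_iff_inner_right] at h
    simpa [hBz] using h
  have hDu : ∀ u, D u = (a ^ 2 * ⟪z, u⟫) • z + a • B u := by
    intro u
    have hu : u = ⟪z, u⟫ • z + (u - ⟪z, u⟫ • z) := by abel
    conv_lhs => rw [hu]
    rw [map_add, map_smul, hDz, hDt ⟨_, hmem u⟩]
    simp only [map_sub, map_smul, hBz, smul_zero, sub_zero, smul_smul]
    rw [mul_comm]
  -- As p = a(z + q) with q ⊥ z, two shears of determinant one turn `D` into `A`.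
  have hfac : A = LinearMap.transvection (innerₛₗ ℝ z) q ∘ₗ D ∘ₗ
      LinearMap.transvection (innerₛₗ ℝ q) z := by
    ext1 u
    have hpq : p = a • q + a • z := by
      rw [hq, smul_sub, smul_smul, mul_inv_cancel₀ hp, one_smul]; abel
    simp only [LinearMap.comp_apply, LinearMap.transvection.apply, innerₛₗ_apply_apply, hDu, hA,
      map_add, map_smul, hBz, smul_zero, add_zero, inner_add_right, real_inner_smul_right, hzz,
      hzB]
    rw [hpq]
    simp only [inner_add_left, real_inner_smul_left]
    module
  rw [hfac, LinearMap.det_comp, LinearMap.det_comp, LinearMap.transvection.det,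
    LinearMap.transvection.det, hDdet]
  simp [hqz, hzq]

end Determinant

/-! ### Spherical derivatives through one-homogeneous extensions -/

section Sphere

variable {n : ℕ} {F : E n → ℝ}

theorem hasFDerivAt_norm_of_ne_zero {x : E n} (hx : x ≠ 0) :
    HasFDerivAt (fun y : E n => ‖y‖) (‖x‖⁻¹ • innerSL ℝ x) x := by
  have h := (hasStrictFDerivAt_norm_sq x).hasFDerivAt.sqrt (by positivity)
  simp only [Real.sqrt_sq (norm_nonneg _)] at h
  have he : (1 / (2 * ‖x‖)) • 2 • innerSL ℝ x = ‖x‖⁻¹ • innerSL ℝ x := by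
    have := norm_ne_zero_iff.2 hx
    rw [two_smul, ← two_smul ℝ, smul_smul]
    congr 1
    field_simp
  rwa [he] at h

theorem radialExt_of_homogeneous (hF : ∀ c : ℝ, 0 < c → ∀ x, F (c • x) = c * F x) {x : E n}
    (hx : x ≠ 0) : radialExt F x = ‖x‖⁻¹ * F x :=
  hF _ (inv_pos.2 (norm_pos_iff.2 hx)) x

/-- The radial extension is F(x)/|x|; by Euler the subtracted term is the normal component of the
Euclidean gradient. -/
theorem sphGrad_of_homogeneous (hF : ∀ c : ℝ, 0 < c → ∀ x, F (c • x) = c * F x) {z : E n}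
    (hd : DifferentiableAt ℝ F z) (hz : ‖z‖ = 1) :
    sphGrad F z = gradient F z - F z • z := by
  have hz0 : z ≠ 0 := by rintro rfl; simp at hz
  have h1 : HasFDerivAt (radialExt F) _ z :=
    (((hasDerivAt_inv (norm_ne_zero_iff.2 hz0)).comp_hasFDerivAt z
      (hasFDerivAt_norm_of_ne_zero hz0)).mul hd.hasFDerivAt).congr_of_eventuallyEq (by
      filter_upwards [isOpen_compl_singleton.mem_nhds hz0] with x hx
      exact radialExt_of_homogeneous hF hx)
  refine ext_inner_right ℝ fun v => ?_
  rw [sphGrad, inner_gradient_left, h1.fderiv, inner_sub_left, inner_gradient_left,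
    real_inner_smul_left]
  simp [hz]
  ring

/-- The operator `∇̄²F + F ḡ` of the sphere is the restriction of the Hessian of the
one-homogeneous function `F`. -/
theorem curvOp_apply_of_homogeneous (hF : ∀ c : ℝ, 0 < c → ∀ x, F (c • x) = c * F x)
    (hs : ContDiffOn ℝ ∞ F {0}ᶜ) {z : E n} (hz : ‖z‖ = 1) (v : tangent z) :
    (curvOp F z v : E n) = fderiv ℝ (gradient F) z v := by
  have hz0 : z ≠ 0 := by rintro rfl; simp at hz
  have hFz := contDiffAt_of_ne_zero hs hz0
  have hGd := (contDiffAt_gradient hFz).differentiableAt (by simp)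
  have hzv : ⟪z, v⟫ = 0 := (Submodule.mem_orthogonal_singleton_iff_inner_right).1 v.2
  have hev : radialExt (sphGrad F) =ᶠ[𝓝 z]
      fun x => gradient F x - ((‖x‖ ^ 2)⁻¹ * F x) • x := by
    filter_upwards [isOpen_compl_singleton.mem_nhds hz0] with x hx
    have hx0 : 0 < ‖x‖ := norm_pos_iff.2 hx
    have hu : ‖‖x‖⁻¹ • x‖ = 1 := norm_smul_inv_norm (𝕜 := ℝ) hx
    have hu0 : ‖x‖⁻¹ • x ≠ 0 := by rw [← norm_ne_zero_iff, hu]; exact one_ne_zero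
    rw [radialExt, sphGrad_of_homogeneous hF
      ((contDiffAt_of_ne_zero hs hu0).differentiableAt (by simp)) hu,
      gradient_smul_of_homogeneous hF (inv_pos.2 hx0), hF _ (inv_pos.2 hx0), smul_smul]
    congr 2
    field_simp
  have h1 := (hGd.hasFDerivAt.sub ((((hasDerivAt_inv (x := ‖z‖ ^ 2)
    (by positivity)).comp_hasFDerivAt z (hasStrictFDerivAt_norm_sq z).hasFDerivAt).mul
    (hFz.differentiableAt (by simp)).hasFDerivAt).smul
    (hasFDerivAt_id z))).congr_of_eventuallyEq hev
  have h2 : fderiv ℝ (radialExt (sphGrad F)) z v =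
      fderiv ℝ (gradient F) z v - (fderiv ℝ F z v • z + F z • (v : E n)) := by
    rw [h1.fderiv]
    simp [hz, hzv]
    module
  -- The Hessian is symmetric and annihilates `z`, so its range is tangent. Projection thus removes
  -- only the multiple of `z`, and the remaining -F v cancels the term F ḡ.
  have hmem : fderiv ℝ (gradient F) z v ∈ tangent z := by
    rw [Submodule.mem_orthogonal_singleton_iff_inner_left, inner_fderiv_gradient_comm hFz,
      fderiv_gradient_self_of_homogeneous hF hGd, inner_zero_left]
  have hP : (tangent z).orthogonalProjectionOnto (fderiv ℝ (radialExt (sphGrad F)) z v) =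
      ⟨fderiv ℝ (gradient F) z v, hmem⟩ - F z • v := by
    have hzP : (tangent z).orthogonalProjectionOnto z = 0 := by
      rw [Submodule.orthogonalProjectionOnto_eq_zero_iff]
      exact Submodule.le_orthogonal_orthogonal _ (Submodule.mem_span_singleton_self z)
    rw [h2, map_sub, map_add, map_smul, map_smul, hzP,
      Submodule.orthogonalProjectionOnto_mem_subspace_eq_self v,
      Submodule.orthogonalProjectionOnto_mem_subspace_eq_self
        (⟨fderiv ℝ (gradient F) z v, hmem⟩ : tangent z)]
    simp
  simp [curvOp, covDeriv, hP]

/-- `σ_{n-1}` expressed through the Jacobian of `∇(F²/2) = F ∇F`. -/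
theorem det_fderiv_smul_gradient (hF : ∀ c : ℝ, 0 < c → ∀ x, F (c • x) = c * F x)
    (hs : ContDiffOn ℝ ∞ F {0}ᶜ) {z : E n} (hz : ‖z‖ = 1) (hFz0 : F z ≠ 0) :
    LinearMap.det (fderiv ℝ (fun x => F x • gradient F x) z : E n →ₗ[ℝ] E n) =
      F z ^ (n + 1) * sigma F z := by
  have hz0 : z ≠ 0 := by rintro rfl; simp at hz
  have hFz := contDiffAt_of_ne_zero hs hz0
  have hFd := hFz.differentiableAt (by simp)
  have hGd := (contDiffAt_gradient hFz).differentiableAt (by simp)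
  have hpz := inner_gradient_self_of_homogeneous hF hFd
  rw [← hpz] at hFz0
  rw [det_rank_one_add hz hFz0 _ (fderiv ℝ (gradient F) z)
    (fderiv_gradient_self_of_homogeneous hF hGd) (curvOp F z)
    (curvOp_apply_of_homogeneous hF hs hz), hpz, sigma]
  intro u
  rw [inner_gradient_left, hpz, ContinuousLinearMap.coe_coe,
    (hFd.hasFDerivAt.fun_smul hGd.hasFDerivAt).fderiv]
  simp [add_comm]

end Sphere

/-! ### Smoothness of an inverse on a domain with boundary -/

section InverseWithin

/-- A continuous right inverse, on a set with unique derivatives, of a smooth map with invertible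
derivatives is smooth. -/
theorem contDiffOn_of_rightInvOn {X : Type*} [NormedAddCommGroup X] [NormedSpace ℝ X]
    [CompleteSpace X] {S : Set X} (hS : UniqueDiffOn ℝ S) {Ψ Θ : X → X}
    (hΨ : ContDiffOn ℝ ∞ Ψ S) (hΘ : ContinuousOn Θ S) (hmaps : MapsTo Θ S S)
    (hinv : RightInvOn Θ Ψ S) (hiso : ∀ p ∈ S, (fderivWithin ℝ Ψ S p).IsInvertible) :
    ContDiffOn ℝ ∞ Θ S := by
  have hderiv : ∀ q ∈ S,
      HasFDerivWithinAt Θ (fderivWithin ℝ Ψ S (Θ q)).inverse S q := by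
    intro q hq
    obtain ⟨e, he⟩ := hiso (Θ q) (hmaps hq)
    have hf : HasFDerivWithinAt Ψ (e : X →L[ℝ] X) S (Θ q) := by
      rw [he]
      exact (hΨ.differentiableOn (by simp) _ (hmaps hq)).hasFDerivWithinAt
    rw [← he, ContinuousLinearMap.inverse_equiv]
    exact hf.of_local_left_inverse ((hΘ q hq).tendsto_nhdsWithin hmaps) hq
      (eventually_mem_nhdsWithin.mono fun x hx => hinv hx)
  have hfd : ContDiffOn ℝ ∞ (fderivWithin ℝ Ψ S) S := hΨ.fderivWithin hS (by norm_cast)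
  -- Bootstrap: the derivative of `Θ` is the inverse of the derivative of `Ψ` at `Θ`, hence C^k as
  -- soon as `Θ` is.
  rw [contDiffOn_infty]
  intro k
  induction k with
  | zero => exact contDiffOn_zero.2 hΘ
  | succ k ih =>
    push_cast
    refine contDiffOn_succ_of_fderivWithin (fun q hq => (hderiv q hq).differentiableWithinAt)
      (by simp) ?_
    refine ContDiffOn.congr (f := fun q => (fderivWithin ℝ Ψ S (Θ q)).inverse) ?_
      fun q hq => (hderiv q hq).fderivWithin (hS q hq)
    intro q hq
    have h1 : ContDiffWithinAt ℝ k (fun q => fderivWithin ℝ Ψ S (Θ q)) S q :=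
      ((hfd.of_le (mod_cast le_top)).comp ih hmaps) q hq
    exact (hiso _ (hmaps hq)).contDiffAt_map_inverse.comp_contDiffWithinAt q h1

end InverseWithin

/-! ### The duality map of a body and of its polar -/

section Duality

variable {n : ℕ} {K : Set (E n)}

/-- The gradient `s ∇s` of half the squared support function of `K`. -/
def dualityMap (K : Set (E n)) (x : E n) : E n :=
  supp K x • gradient (supp K) x

theorem dualityMap_smul (K : Set (E n)) {c : ℝ} (hc : 0 < c) (x : E n) :
    dualityMap K (c • x) = c • dualityMap K x := by
  rw [dualityMap, dualityMap, supp_smul K hc.le,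
    gradient_smul_of_homogeneous (fun c hc y => supp_smul K hc.le y) hc, mul_smul]

theorem fderiv_dualityMap_smul (K : Set (E n)) {c : ℝ} (hc : 0 < c) (x : E n) :
    fderiv ℝ (dualityMap K) (c • x) = fderiv ℝ (dualityMap K) x := by
  have h1 : fderiv ℝ (fun y => dualityMap K (c • y)) x = c • fderiv ℝ (dualityMap K) (c • x) :=
    fderiv_comp_smul c
  have h2 : (fun y => dualityMap K (c • y)) = c • dualityMap K :=
    funext fun y => by simp [dualityMap_smul K hc]
  rw [h2, fderiv_const_smul_field] at h1
  exact (smul_right_injective _ hc.ne' h1).symm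

theorem contDiffAt_dualityMap (hs : ContDiffOn ℝ ∞ (supp K) {0}ᶜ) {x : E n} (hx : x ≠ 0) :
    ContDiffAt ℝ ∞ (dualityMap K) x :=
  (contDiffAt_of_ne_zero hs hx).smul (contDiffAt_gradient (contDiffAt_of_ne_zero hs hx))

theorem fderiv_dualityMap_apply (hs : ContDiffOn ℝ ∞ (supp K) {0}ᶜ) {x : E n} (hx : x ≠ 0)
    (v : E n) : fderiv ℝ (dualityMap K) x v =
      supp K x • fderiv ℝ (gradient (supp K)) x v + fderiv ℝ (supp K) x v • gradient (supp K) x := by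
  have hd := contDiffAt_of_ne_zero hs hx
  have h : HasFDerivAt (dualityMap K) _ x :=
    (hd.differentiableAt (by simp)).hasFDerivAt.smul
      ((contDiffAt_gradient hd).differentiableAt (by simp)).hasFDerivAt
  rw [h.fderiv]
  simp

/-- Pairing with `v` gives s D²s(v, v) + (ds v)², a sum of nonnegative terms. The vanishing of the
first makes `v` radial, and that of the second then makes it zero. -/
theorem fderiv_dualityMap_injective (hK : IsSmoothStrictlyConvexBody K) (h0 : 0 ∈ interior K)
    (hs : ContDiffOn ℝ ∞ (supp K) {0}ᶜ) {x : E n} (hx : x ≠ 0) {v : E n}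
    (hv : fderiv ℝ (dualityMap K) x v = 0) : v = 0 := by
  have hne : K.Nonempty := ⟨0, interior_subset h0⟩
  have hpos := supp_pos hK.isCompact h0 hx
  have hd := (contDiffAt_of_ne_zero hs hx).differentiableAt (by simp)
  have hself : fderiv ℝ (supp K) x x = supp K x := by
    rw [← inner_gradient_left, inner_gradient_self_of_homogeneous
      (fun c hc y => supp_smul K hc.le y) hd]
  have h1 := congrArg (fun u => ⟪u, v⟫) hv
  simp only [fderiv_dualityMap_apply hs hx, inner_add_left, real_inner_smul_left,
    inner_gradient_left, inner_zero_left] at h1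
  have h2 := inner_fderiv_gradient_supp_nonneg hK.isCompact hne hs hx v
  have h3 : supp K x * ⟪fderiv ℝ (gradient (supp K)) x v, v⟫ = 0 := by
    nlinarith [mul_nonneg hpos.le h2, mul_self_nonneg (fderiv ℝ (supp K) x v)]
  have h4 : fderiv ℝ (supp K) x v = 0 := by
    rw [h3, zero_add] at h1
    exact mul_self_eq_zero.1 h1
  by_contra hv0
  refine (inner_fderiv_gradient_supp_pos hK hs hx (v := v) fun c hc => hv0 ?_).ne'
    ((mul_eq_zero.1 h3).resolve_left hpos.ne')
  rw [hc, map_smul, hself, smul_eq_mul] at h4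
  rw [hc, (mul_eq_zero.1 h4).resolve_right hpos.ne', zero_smul]

section

variable {x z : E n}

theorem inner_dualityMap_self (hd : DifferentiableAt ℝ (supp K) x) :
    ⟪dualityMap K x, x⟫ = supp K x ^ 2 := by
  rw [dualityMap, real_inner_smul_left, inner_gradient_self_of_homogeneous
    (fun c hc y => supp_smul K hc.le y) hd, sq]

theorem inv_supp_smul_mem_polarBody (hK : IsCompact K) (h0 : 0 ∈ interior K) (hx : x ≠ 0) :
    (supp K x)⁻¹ • x ∈ polarBody K := by
  have hpos := supp_pos hK h0 hx
  rw [mem_polarBody_iff hK ⟨0, interior_subset h0⟩, supp_smul K (inv_nonneg.2 hpos.le),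
    inv_mul_cancel₀ hpos.ne']

/-- Upper bound: ∇s(x) lies in `K`, so it pairs to at most 1 with the polar body. Lower bound: the
point x/s(x) of the polar body attains it. -/
theorem supp_polarBody_dualityMap (hK : IsCompact K) (h0 : 0 ∈ interior K) (hx : x ≠ 0)
    (hd : DifferentiableAt ℝ (supp K) x) : supp (polarBody K) (dualityMap K x) = supp K x := by
  have hpos := supp_pos hK h0 hx
  have hne : K.Nonempty := ⟨0, interior_subset h0⟩
  have hcomp := isCompact_polarBody h0
  apply le_antisymm
  · obtain ⟨w, hw, hzw⟩ := exists_inner_eq_supp hcomp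
      ⟨0, interior_subset (zero_mem_interior_polarBody hK)⟩ (dualityMap K x)
    rw [← hzw, dualityMap, real_inner_smul_left, real_inner_comm]
    exact mul_le_of_le_one_right hpos.le (hw _ (gradient_supp_mem hK hne hd))
  · have := inner_le_supp hcomp (dualityMap K x) (inv_supp_smul_mem_polarBody hK h0 hx)
    rw [real_inner_smul_right, inner_dualityMap_self hd] at this
    refine le_trans (le_of_eq ?_) this
    field_simp

theorem gradient_supp_polarBody_dualityMap (hK : IsCompact K) (h0 : 0 ∈ interior K) (hx : x ≠ 0)
    (hd : DifferentiableAt ℝ (supp K) x)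
    (hd' : DifferentiableAt ℝ (supp (polarBody K)) (dualityMap K x)) :
    gradient (supp (polarBody K)) (dualityMap K x) = (supp K x)⁻¹ • x := by
  have hpos := supp_pos hK h0 hx
  refine gradient_supp_eq (isCompact_polarBody h0) (inv_supp_smul_mem_polarBody hK h0 hx) ?_ hd'
  rw [supp_polarBody_dualityMap hK h0 hx hd, real_inner_smul_right, inner_dualityMap_self hd]
  field_simp

/-- The image determines s(x), as the value there of the polar support function, and then the
supporting point ∇s(x). Uniqueness of normals gives x' = c x, and equal values of s give c = 1. -/
theorem dualityMap_injective (hK : IsSmoothStrictlyConvexBody K) (h0 : 0 ∈ interior K)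
    (hs : ContDiffOn ℝ ∞ (supp K) {0}ᶜ) {x x' : E n} (hx : x ≠ 0) (hx' : x' ≠ 0)
    (h : dualityMap K x = dualityMap K x') : x = x' := by
  have hne : K.Nonempty := ⟨0, interior_subset h0⟩
  have hd := (contDiffAt_of_ne_zero hs hx).differentiableAt (by simp)
  have hd' := (contDiffAt_of_ne_zero hs hx').differentiableAt (by simp)
  have hpos := supp_pos hK.isCompact h0 hx
  have e1 : supp K x = supp K x' := by
    rw [← supp_polarBody_dualityMap hK.isCompact h0 hx hd, h,
      supp_polarBody_dualityMap hK.isCompact h0 hx' hd']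
  have e2 : gradient (supp K) x = gradient (supp K) x' := by
    rw [dualityMap, dualityMap, ← e1] at h
    exact smul_right_injective _ hpos.ne' h
  obtain ⟨c, hc, hcx⟩ := exists_eq_smul_of_isMaxOn hK hx hx'
    (gradient_supp_mem hK.isCompact hne hd)
    (fun k hk => by
      rw [inner_gradient_supp hK.isCompact hne hd]; exact inner_le_supp hK.isCompact x hk)
    (fun k hk => by
      rw [e2, inner_gradient_supp hK.isCompact hne hd']; exact inner_le_supp hK.isCompact x' hk)
  rw [hcx, supp_smul K hc.le] at e1
  have : c = 1 := by
    have : (c - 1) * supp K x = 0 := by linarith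
    linarith [(mul_eq_zero.1 this).resolve_right hpos.ne']
  rw [hcx, this, one_smul]

/-- A maximiser w of ⟪z, ·⟫ on K* = {s ≤ 1} satisfies z = c ∇s(w) by the multiplier rule. Rescaling
w by c/s(w) adjusts the factor, since the duality map is one-homogeneous. -/
theorem exists_dualityMap_eq (hK : IsSmoothStrictlyConvexBody K) (h0 : 0 ∈ interior K)
    (hs : ContDiffOn ℝ ∞ (supp K) {0}ᶜ) (hz : z ≠ 0) : ∃ y, y ≠ 0 ∧ dualityMap K y = z := by
  have hne : K.Nonempty := ⟨0, interior_subset h0⟩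
  have hcomp := isCompact_polarBody h0
  have hint := zero_mem_interior_polarBody hK.isCompact
  obtain ⟨w, hw, hzw⟩ := exists_inner_eq_supp hcomp ⟨0, interior_subset hint⟩ z
  have hw0 : w ≠ 0 := by
    rintro rfl
    rw [inner_zero_right] at hzw
    exact (supp_pos hcomp hint hz).ne hzw
  have hd := (contDiffAt_of_ne_zero hs hw0).differentiableAt (by simp)
  have hpos := supp_pos hK.isCompact h0 hw0
  have hgrad : gradient (fun y => supp K y - 1) w = gradient (supp K) w := by
    rw [gradient, gradient, fderiv_sub_const]
  obtain ⟨c, hc, hzc⟩ := exists_eq_smul_gradient (K := polarBody K) (U := {0}ᶜ)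
    (ρ := fun y => supp K y - 1) (x := z) (y := w) isOpen_compl_singleton (by
      ext y
      simp only [mem_inter_iff, mem_polarBody_iff hK.isCompact hne, mem_ofPred_eq, sub_nonpos]
      exact and_comm) hw0 (hd.sub_const 1) (by
      rw [fderiv_sub_const]
      intro h
      have := inner_gradient_self_of_homogeneous (fun c hc y => supp_smul K hc.le y) hd
      rw [inner_gradient_left, h] at this
      exact hpos.ne this) hw (fun k hk => by rw [hzw]; exact inner_le_supp hcomp z hk)
  rw [hgrad] at hzc
  have hc0 : 0 < c := hc.lt_of_ne (by rintro rfl; rw [zero_smul] at hzc; exact hz hzc)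
  refine ⟨(c / supp K w) • w, smul_ne_zero (div_pos hc0 hpos).ne' hw0, ?_⟩
  rw [dualityMap_smul K (div_pos hc0 hpos), dualityMap, smul_smul, div_mul_cancel₀ _ hpos.ne', hzc]

end

/-- The product of the Jacobians of the duality maps of `K` and of its polar body is one. -/
theorem det_fderiv_dualityMap_mul (hK : IsSmoothStrictlyConvexBody K) (h0 : 0 ∈ interior K)
    (hs : ContDiffOn ℝ ∞ (supp K) {0}ᶜ) (hs' : ContDiffOn ℝ ∞ (supp (polarBody K)) {0}ᶜ)
    {y z : E n} (hy : y ≠ 0) (hz : z ≠ 0) (hyz : dualityMap K y = z) :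
    LinearMap.det (fderiv ℝ (dualityMap K) y : E n →ₗ[ℝ] E n) *
      LinearMap.det (fderiv ℝ (dualityMap (polarBody K)) z : E n →ₗ[ℝ] E n) = 1 := by
  have hinv : ∀ y' z' : E n, y' ≠ 0 → z' ≠ 0 → dualityMap K y' = z' →
      dualityMap (polarBody K) z' = y' := by
    rintro y' z' hy' hz' rfl
    have hd := (contDiffAt_of_ne_zero hs hy').differentiableAt (by simp)
    have hd' := (contDiffAt_of_ne_zero hs' hz').differentiableAt (by simp)
    rw [dualityMap, gradient_supp_polarBody_dualityMap hK.isCompact h0 hy' hd hd',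
      supp_polarBody_dualityMap hK.isCompact h0 hy' hd, smul_smul,
      mul_inv_cancel₀ (supp_pos hK.isCompact h0 hy').ne', one_smul]
  have hev : (dualityMap K ∘ dualityMap (polarBody K)) =ᶠ[𝓝 z] id := by
    filter_upwards [isOpen_compl_singleton.mem_nhds hz] with z' hz'
    obtain ⟨y', hy', hyz'⟩ := exists_dualityMap_eq hK h0 hs hz'
    rw [Function.comp_apply, hinv y' z' hy' hz' hyz', hyz', id]
  have h1 : HasFDerivAt (dualityMap (polarBody K)) (fderiv ℝ (dualityMap (polarBody K)) z) z :=
    ((contDiffAt_dualityMap hs' hz).differentiableAt (by simp)).hasFDerivAt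
  have h2 : HasFDerivAt (dualityMap K) (fderiv ℝ (dualityMap K) y)
      (dualityMap (polarBody K) z) := by
    rw [hinv y z hy hz hyz]
    exact ((contDiffAt_dualityMap hs hy).differentiableAt (by simp)).hasFDerivAt
  have h3 := (h2.comp z h1).unique ((hasFDerivAt_id z).congr_of_eventuallyEq hev)
  rw [← LinearMap.det_comp, ← ContinuousLinearMap.toLinearMap_comp, h3]
  exact LinearMap.det_id

end Duality

/-! ### Smooth dependence on time -/

section Family

variable {n : ℕ} {T : ℝ} {K : ℝ → Set (E n)}

theorem uniqueDiffOn_compl_zero_prod (n : ℕ) (T : ℝ) :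
    UniqueDiffOn ℝ (({0}ᶜ : Set (E n)) ×ˢ Ico 0 T) :=
  isOpen_compl_singleton.uniqueDiffOn.prod (uniqueDiffOn_Ico 0 T)

/-- Passes between the 0-homogeneous extension used in `EvolvesBy` and the one-homogeneous one; they
differ by the factor |x|, smooth off the origin. -/
theorem contDiffOn_supp_iff :
    ContDiffOn ℝ ∞ (fun p : E n × ℝ => radialExt (supp (K p.2)) p.1) ({0}ᶜ ×ˢ Ico 0 T) ↔
      ContDiffOn ℝ ∞ (fun p : E n × ℝ => supp (K p.2) p.1) ({0}ᶜ ×ˢ Ico 0 T) := by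
  have hn : ContDiffOn ℝ ∞ (fun p : E n × ℝ => ‖p.1‖) ({0}ᶜ ×ˢ Ico 0 T) :=
    contDiffOn_fst.norm ℝ fun p hp => hp.1
  have hn0 : ∀ p ∈ ({0}ᶜ : Set (E n)) ×ˢ Ico 0 T, ‖p.1‖ ≠ 0 := fun p hp => norm_ne_zero_iff.2 hp.1
  have hrad : ∀ p ∈ ({0}ᶜ : Set (E n)) ×ˢ Ico 0 T,
      radialExt (supp (K p.2)) p.1 = ‖p.1‖⁻¹ * supp (K p.2) p.1 := fun p hp =>
    radialExt_of_homogeneous (fun c hc y => supp_smul _ hc.le y) hp.1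
  constructor
  · intro h
    refine (hn.mul h).congr fun p hp => ?_
    rw [hrad p hp, mul_inv_cancel_left₀ (hn0 p hp)]
  · intro h
    exact ((hn.inv hn0).mul h).congr hrad

theorem hasFDerivAt_slice {G : Type*} [NormedAddCommGroup G] [NormedSpace ℝ G] {f : E n × ℝ → G}
    {f' : E n × ℝ →L[ℝ] G} {x : E n} {t : ℝ} (hx : x ≠ 0) (ht : t ∈ Ico 0 T)
    (hf : HasFDerivWithinAt f f' ({0}ᶜ ×ˢ Ico 0 T) (x, t)) :
    HasFDerivAt (fun y => f (y, t)) (f'.comp (ContinuousLinearMap.inl ℝ (E n) ℝ)) x := by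
  have h1 : HasFDerivWithinAt (fun y : E n => (y, t)) (ContinuousLinearMap.inl ℝ (E n) ℝ) {0}ᶜ x :=
    (hasFDerivAt_prodMk_left x t).hasFDerivWithinAt
  exact (HasFDerivWithinAt.comp x hf h1 (t := {0}ᶜ ×ˢ Ico 0 T) fun y hy => ⟨hy, ht⟩).hasFDerivAt
    (isOpen_compl_singleton.mem_nhds hx)

theorem contDiffOn_slice {f : E n × ℝ → ℝ} {t : ℝ} (ht : t ∈ Ico 0 T)
    (hf : ContDiffOn ℝ ∞ f ({0}ᶜ ×ˢ Ico 0 T)) : ContDiffOn ℝ ∞ (fun y => f (y, t)) {0}ᶜ :=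
  hf.comp (contDiff_prodMk_left t).contDiffOn fun _ hy => ⟨hy, ht⟩

theorem contDiffOn_gradient_slice {f : E n × ℝ → ℝ}
    (hf : ContDiffOn ℝ ∞ f ({0}ᶜ ×ˢ Ico 0 T)) :
    ContDiffOn ℝ ∞ (fun p : E n × ℝ => gradient (fun y => f (y, p.2)) p.1)
      ({0}ᶜ ×ˢ Ico 0 T) := by
  have hfd := hf.fderivWithin (uniqueDiffOn_compl_zero_prod n T) (m := ∞) (by norm_cast)
  have h1 : ContDiffOn ℝ ∞ (fun p => (InnerProductSpace.toDual ℝ (E n)).symm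
      ((fderivWithin ℝ f ({0}ᶜ ×ˢ Ico 0 T) p).comp (ContinuousLinearMap.inl ℝ (E n) ℝ)))
      ({0}ᶜ ×ˢ Ico 0 T) :=
    (InnerProductSpace.toDual ℝ (E n)).symm.contDiff.comp_contDiffOn (hfd.clm_comp contDiffOn_const)
  refine h1.congr fun p hp => ?_
  have := hasFDerivAt_slice (T := T) (x := p.1) (t := p.2) hp.1 hp.2
    (hf.differentiableOn (by simp) p hp).hasFDerivWithinAt
  rw [gradient, this.fderiv]

variable (K) in
/-- The duality maps of a family of bodies, as a map of space-time. -/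
def dualityFlow (p : E n × ℝ) : E n × ℝ :=
  (dualityMap (K p.2) p.1, p.2)

theorem contDiffOn_dualityFlow
    (hs : ContDiffOn ℝ ∞ (fun p : E n × ℝ => supp (K p.2) p.1) ({0}ᶜ ×ˢ Ico 0 T)) :
    ContDiffOn ℝ ∞ (dualityFlow K) ({0}ᶜ ×ˢ Ico 0 T) :=
  (hs.smul (contDiffOn_gradient_slice hs)).prodMk contDiffOn_snd

/-- The derivative is block triangular: it preserves the time component and acts on space by the
injective derivative of the duality map. -/
theorem isInvertible_fderivWithin_dualityFlow
    (hK : ∀ t ∈ Ico 0 T, IsSmoothStrictlyConvexBody (K t)) (h0 : ∀ t ∈ Ico 0 T, 0 ∈ interior (K t))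
    (hs : ContDiffOn ℝ ∞ (fun p : E n × ℝ => supp (K p.2) p.1) ({0}ᶜ ×ˢ Ico 0 T))
    {p : E n × ℝ} (hp : p ∈ ({0}ᶜ : Set (E n)) ×ˢ Ico 0 T) :
    (fderivWithin ℝ (dualityFlow K) ({0}ᶜ ×ˢ Ico 0 T) p).IsInvertible := by
  have hD := ((contDiffOn_dualityFlow hs).differentiableOn (by simp) p hp).hasFDerivWithinAt
  set L := fderivWithin ℝ (dualityFlow K) ({0}ᶜ ×ˢ Ico 0 T) p with hL
  have hu := uniqueDiffOn_compl_zero_prod n T p hp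
  have hsnd : ∀ u, (L u).2 = u.2 := by
    intro u
    have h1 : HasFDerivWithinAt (fun q : E n × ℝ => q.2)
        ((ContinuousLinearMap.snd ℝ (E n) ℝ).comp L) ({0}ᶜ ×ˢ Ico 0 T) p :=
      (ContinuousLinearMap.snd ℝ (E n) ℝ).hasFDerivAt.comp_hasFDerivWithinAt p
        (f := dualityFlow K) hD
    exact congrArg (fun M => M u) (hu.eq h1 hasFDerivWithinAt_snd)
  have hfst : ∀ v, (L (v, 0)).1 = fderiv ℝ (dualityMap (K p.2)) p.1 v := by
    intro v
    have h1 := (ContinuousLinearMap.fst ℝ (E n) ℝ).hasFDerivAt.comp p.1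
      (hasFDerivAt_slice (T := T) (x := p.1) (t := p.2) hp.1 hp.2 hD)
    have h2 : HasFDerivAt (dualityMap (K p.2)) _ p.1 := h1
    rw [h2.fderiv]
    simp
  have hinj : Function.Injective L := by
    rw [injective_iff_map_eq_zero]
    rintro ⟨v, τ⟩ hu
    have hτ : τ = 0 := by simpa [hu] using (hsnd (v, τ)).symm
    subst hτ
    have := hfst v
    rw [hu] at this
    rw [fderiv_dualityMap_injective (hK _ hp.2) (h0 _ hp.2) (contDiffOn_slice hp.2 hs) hp.1
      this.symm]
    rfl
  exact ⟨(LinearEquiv.ofInjectiveEndo L.toLinearMap hinj).toContinuousLinearEquiv, rfl⟩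

theorem exists_norm_bounds
    (hK : ∀ t ∈ Ico 0 T, IsSmoothStrictlyConvexBody (K t)) (h0 : ∀ t ∈ Ico 0 T, 0 ∈ interior (K t))
    (hs : ContDiffOn ℝ ∞ (fun p : E n × ℝ => supp (K p.2) p.1) ({0}ᶜ ×ˢ Ico 0 T))
    {t₁ : ℝ} (ht₁ : t₁ ∈ Ico 0 T) (hn : ∃ x : E n, x ≠ 0) :
    ∃ m M : ℝ, 0 < m ∧ 0 < M ∧ ∀ t ∈ Icc 0 t₁, ∀ x : E n, x ≠ 0 →
      m * ‖x‖ ≤ supp (K t) x ∧ supp (K t) x ≤ M * ‖x‖ := by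
  obtain ⟨x₀, hx₀⟩ := hn
  have hsub : Metric.sphere (0 : E n) 1 ×ˢ Icc 0 t₁ ⊆ {0}ᶜ ×ˢ Ico 0 T :=
    prod_mono (fun x hx => ne_zero_of_mem_unit_sphere ⟨x, hx⟩)
      (fun t ht => ⟨ht.1, ht.2.trans_lt ht₁.2⟩)
  have hcomp : IsCompact (Metric.sphere (0 : E n) 1 ×ˢ Icc 0 t₁) :=
    (isCompact_sphere 0 1).prod isCompact_Icc
  have hunit : ∀ x : E n, x ≠ 0 → ‖x‖⁻¹ • x ∈ Metric.sphere (0 : E n) 1 := fun x hx => by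
    rw [mem_sphere_zero_iff_norm]; exact norm_smul_inv_norm (𝕜 := ℝ) hx
  have hne : (Metric.sphere (0 : E n) 1 ×ˢ Icc 0 t₁).Nonempty :=
    ⟨(_, 0), hunit x₀ hx₀, ⟨le_rfl, ht₁.1⟩⟩
  have hcont := hs.continuousOn.mono hsub
  obtain ⟨p, hp, hmin⟩ := hcomp.exists_isMinOn hne hcont
  obtain ⟨q, hq, hmax⟩ := hcomp.exists_isMaxOn hne hcont
  have hpos : ∀ p ∈ Metric.sphere (0 : E n) 1 ×ˢ Icc 0 t₁, 0 < supp (K p.2) p.1 := fun p hp =>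
    supp_pos (hK _ (hsub hp).2).isCompact (h0 _ (hsub hp).2) (hsub hp).1
  refine ⟨supp (K p.2) p.1, supp (K q.2) q.1, hpos p hp, hpos q hq, fun t ht x hx => ?_⟩
  have hx0 : 0 < ‖x‖ := norm_pos_iff.2 hx
  have h1 := isMinOn_iff.1 hmin (‖x‖⁻¹ • x, t) ⟨hunit x hx, ht⟩
  have h2 := isMaxOn_iff.1 hmax (‖x‖⁻¹ • x, t) ⟨hunit x hx, ht⟩
  simp only [supp_smul _ (inv_nonneg.2 hx0.le)] at h1 h2
  rw [inv_mul_eq_div] at h1 h2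
  exact ⟨(le_div_iff₀ hx0).1 h1, (div_le_iff₀ hx0).1 h2⟩

/-- Near a base point the values of `Y` stay in a compact shell away from the origin. By continuity
of the flow, a cluster point has the same image as the value at the base point, so injectivity
identifies the two. -/
theorem continuousOn_of_dualityMap_eq
    (hK : ∀ t ∈ Ico 0 T, IsSmoothStrictlyConvexBody (K t)) (h0 : ∀ t ∈ Ico 0 T, 0 ∈ interior (K t))
    (hs : ContDiffOn ℝ ∞ (fun p : E n × ℝ => supp (K p.2) p.1) ({0}ᶜ ×ˢ Ico 0 T))
    {Y : E n × ℝ → E n} (hY0 : ∀ p ∈ ({0}ᶜ : Set (E n)) ×ˢ Ico 0 T, Y p ≠ 0)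
    (hY : ∀ p ∈ ({0}ᶜ : Set (E n)) ×ˢ Ico 0 T, dualityMap (K p.2) (Y p) = p.1) :
    ContinuousOn Y ({0}ᶜ ×ˢ Ico 0 T) := by
  rintro ⟨z₀, t₀⟩ hp₀
  obtain ⟨t₁, ht₀₁, ht₁⟩ := exists_between hp₀.2.2
  have ht₁' : t₁ ∈ Ico 0 T := ⟨hp₀.2.1.trans ht₀₁.le, ht₁⟩
  obtain ⟨m, M, hm, hM, hmM⟩ := exists_norm_bounds hK h0 hs ht₁' ⟨z₀, hp₀.1⟩
  have hz₀ : 0 < ‖z₀‖ := norm_pos_iff.2 hp₀.1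
  -- For ‖z₀‖/2 < |z| < 2‖z₀‖: |z| = s(Y)|∇s(Y)| ≤ M²|Y| gives the inner radius, and m²|Y|² ≤ s(Y)²
  -- = ⟪z, Y⟫ ≤ |z||Y| the outer one.
  set a := ‖z₀‖ / 2 / M ^ 2 with ha
  set b := 2 * ‖z₀‖ / m ^ 2 with hb
  have ha0 : 0 < a := by positivity
  have hC : IsCompact (Metric.closedBall (0 : E n) b ∩ {x | a ≤ ‖x‖}) :=
    (isCompact_closedBall 0 b).inter_right (isClosed_le continuous_const continuous_norm)
  have hnorm : Tendsto (fun q : E n × ℝ => ‖q.1‖) (𝓝[{0}ᶜ ×ˢ Ico 0 T] (z₀, t₀)) (𝓝 ‖z₀‖) :=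
    ((continuous_norm.comp continuous_fst).tendsto (z₀, t₀)).mono_left nhdsWithin_le_nhds
  have htime : Tendsto (fun q : E n × ℝ => q.2) (𝓝[{0}ᶜ ×ˢ Ico 0 T] (z₀, t₀)) (𝓝 t₀) :=
    (continuous_snd.tendsto (z₀, t₀)).mono_left nhdsWithin_le_nhds
  refine hC.tendsto_nhds_of_unique_mapClusterPt ?_ ?_
  · filter_upwards [self_mem_nhdsWithin, hnorm.eventually (lt_mem_nhds (half_lt_self hz₀)),
      hnorm.eventually (gt_mem_nhds (show ‖z₀‖ < 2 * ‖z₀‖ by linarith)),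
      htime.eventually (gt_mem_nhds ht₀₁)] with q hq h1 h2 h3
    have hbody := hK _ hq.2
    have hd : DifferentiableAt ℝ (supp (K q.2)) (Y q) :=
      (contDiffAt_of_ne_zero (contDiffOn_slice hq.2 hs) (hY0 q hq)).differentiableAt (by simp)
    have hne : (K q.2).Nonempty := ⟨0, interior_subset (h0 _ hq.2)⟩
    obtain ⟨b1, b2⟩ := hmM q.2 ⟨hq.2.1, h3.le⟩ (Y q) (hY0 q hq)
    have hy : 0 < ‖Y q‖ := norm_pos_iff.2 (hY0 q hq)
    constructor
    · rw [mem_closedBall_zero_iff, hb, le_div_iff₀ (by positivity)]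
      have e1 := inner_dualityMap_self hd
      rw [hY q hq] at e1
      have e2 := real_inner_le_norm q.1 (Y q)
      have e3 : (m * ‖Y q‖) ^ 2 ≤ supp (K q.2) (Y q) ^ 2 := by gcongr
      have e4 : (‖Y q‖ * m ^ 2) * ‖Y q‖ ≤ ‖q.1‖ * ‖Y q‖ := by nlinarith
      linarith [le_of_mul_le_mul_right e4 hy]
    · change a ≤ ‖Y q‖
      rw [ha, div_le_iff₀ (by positivity)]
      have hsupp0 := supp_pos hbody.isCompact (h0 _ hq.2) (hY0 q hq)
      have e1 : ‖q.1‖ = supp (K q.2) (Y q) * ‖gradient (supp (K q.2)) (Y q)‖ := by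
        conv_lhs => rw [← hY q hq]
        rw [dualityMap, norm_smul, Real.norm_of_nonneg hsupp0.le]
      have e2 : ‖gradient (supp (K q.2)) (Y q)‖ ≤ M := by
        have hk := gradient_supp_mem hbody.isCompact hne hd
        set k := gradient (supp (K q.2)) (Y q) with hkdef
        rcases eq_or_ne k 0 with hk0 | hk0
        · rw [hk0, norm_zero]; exact hM.le
        have f1 := inner_le_supp hbody.isCompact k hk
        have f2 := (hmM q.2 ⟨hq.2.1, h3.le⟩ k hk0).2
        rw [real_inner_self_eq_norm_sq] at f1
        have hk1 : 0 < ‖k‖ := norm_pos_iff.2 hk0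
        exact le_of_mul_le_mul_right (by nlinarith) hk1
      have e3 : ‖q.1‖ ≤ M * ‖Y q‖ * M := by
        rw [e1]; gcongr
      nlinarith
  · intro x hx hclus
    obtain ⟨u, hu, hux⟩ := mapClusterPt_iff_ultrafilter.1 hclus
    have hx0 : x ≠ 0 := by
      rintro rfl
      have : a ≤ ‖(0 : E n)‖ := hx.2
      rw [norm_zero] at this
      linarith
    have hmem : ∀ᶠ q in (u : Filter (E n × ℝ)), q ∈ ({0}ᶜ : Set (E n)) ×ˢ Ico 0 T :=
      hu self_mem_nhdsWithin
    have h1 : Tendsto (fun q => (Y q, q.2)) u (𝓝[{0}ᶜ ×ˢ Ico 0 T] (x, t₀)) := by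
      refine tendsto_nhdsWithin_iff.2 ⟨hux.prodMk_nhds (htime.mono_left hu), ?_⟩
      filter_upwards [hmem] with q hq using ⟨hY0 q hq, hq.2⟩
    have hcont : ContinuousWithinAt (dualityFlow K) ({0}ᶜ ×ˢ Ico 0 T) (x, t₀) :=
      (contDiffOn_dualityFlow hs).continuousOn _ ⟨hx0, hp₀.2⟩
    have h2 : Tendsto (fun q => dualityFlow K (Y q, q.2)) u (𝓝 (dualityFlow K (x, t₀))) :=
      hcont.tendsto.comp h1
    have h3 : Tendsto (fun q => dualityFlow K (Y q, q.2)) u (𝓝 (z₀, t₀)) := by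
      refine Tendsto.congr' ?_ (hu.trans nhdsWithin_le_nhds)
      filter_upwards [hmem] with q hq
      exact Prod.ext (hY q hq).symm rfl
    have h4 := congrArg Prod.fst (tendsto_nhds_unique h2 h3)
    refine dualityMap_injective (hK _ hp₀.2) (h0 _ hp₀.2) (contDiffOn_slice hp₀.2 hs) hx0
      (hY0 _ hp₀) ?_
    rw [hY _ hp₀]
    exact h4

/-- The inverse of the duality maps is smooth in space-time. -/
theorem exists_contDiffOn_dualityMap_eq
    (hK : ∀ t ∈ Ico 0 T, IsSmoothStrictlyConvexBody (K t)) (h0 : ∀ t ∈ Ico 0 T, 0 ∈ interior (K t))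
    (hs : ContDiffOn ℝ ∞ (fun p : E n × ℝ => supp (K p.2) p.1) ({0}ᶜ ×ˢ Ico 0 T)) :
    ∃ Y : E n × ℝ → E n, ContDiffOn ℝ ∞ Y ({0}ᶜ ×ˢ Ico 0 T) ∧
      ∀ p ∈ ({0}ᶜ : Set (E n)) ×ˢ Ico 0 T, Y p ≠ 0 ∧ dualityMap (K p.2) (Y p) = p.1 := by
  have hex : ∀ p : E n × ℝ, p ∈ ({0}ᶜ : Set (E n)) ×ˢ Ico 0 T →
      ∃ y, y ≠ 0 ∧ dualityMap (K p.2) y = p.1 := fun p hp =>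
    exists_dualityMap_eq (hK _ hp.2) (h0 _ hp.2) (contDiffOn_slice hp.2 hs) hp.1
  choose! Y hY using hex
  refine ⟨Y, ?_, hY⟩
  have hcont := continuousOn_of_dualityMap_eq hK h0 hs (fun p hp => (hY p hp).1)
    fun p hp => (hY p hp).2
  have h := contDiffOn_of_rightInvOn (uniqueDiffOn_compl_zero_prod n T)
    (contDiffOn_dualityFlow hs) (Θ := fun p => (Y p, p.2)) (hcont.prodMk continuousOn_snd)
    (fun p hp => ⟨(hY p hp).1, hp.2⟩) (fun p hp => Prod.ext (hY p hp).2 rfl)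
    fun p hp => isInvertible_fderivWithin_dualityFlow hK h0 hs hp
  exact contDiff_fst.comp_contDiffOn h

end Family

/-! ### Speed, curvature and gradient at dual points -/

section Evolution

variable {n : ℕ} {T : ℝ} {K : ℝ → Set (E n)}

theorem supp_polarBody_eq {L : Set (E n)} (hL : IsCompact L) (h0 : 0 ∈ interior L)
    (hs : ContDiffOn ℝ ∞ (supp L) {0}ᶜ) {y z : E n} (hy : y ≠ 0) (hyz : dualityMap L y = z) :
    supp (polarBody L) z = supp L y := by
  rw [← hyz, supp_polarBody_dualityMap hL h0 hy
    ((contDiffAt_of_ne_zero hs hy).differentiableAt (by simp))]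

theorem contDiffOn_supp_polarBody
    (hK : ∀ t ∈ Ico 0 T, IsSmoothStrictlyConvexBody (K t)) (h0 : ∀ t ∈ Ico 0 T, 0 ∈ interior (K t))
    (hs : ContDiffOn ℝ ∞ (fun p : E n × ℝ => supp (K p.2) p.1) ({0}ᶜ ×ˢ Ico 0 T)) :
    ContDiffOn ℝ ∞ (fun p : E n × ℝ => supp (polarBody (K p.2)) p.1) ({0}ᶜ ×ˢ Ico 0 T) := by
  obtain ⟨Y, hYs, hY⟩ := exists_contDiffOn_dualityMap_eq hK h0 hs
  have h := hs.comp (hYs.prodMk contDiffOn_snd) fun p hp => ⟨(hY p hp).1, hp.2⟩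
  exact h.congr fun p hp => supp_polarBody_eq (hK _ hp.2).isCompact (h0 _ hp.2)
    (contDiffOn_slice hp.2 hs) (hY p hp).1 (hY p hp).2

/-- At dual points, the support functions of a family and of its polar family have opposite time
derivatives. -/
theorem hasDerivWithinAt_supp_polarBody
    (hK : ∀ t ∈ Ico 0 T, IsSmoothStrictlyConvexBody (K t)) (h0 : ∀ t ∈ Ico 0 T, 0 ∈ interior (K t))
    (hs : ContDiffOn ℝ ∞ (fun p : E n × ℝ => supp (K p.2) p.1) ({0}ᶜ ×ˢ Ico 0 T))
    {t : ℝ} (ht : t ∈ Ico 0 T) {y z : E n} (hy : y ≠ 0) (hz : z ≠ 0)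
    (hyz : dualityMap (K t) y = z) {d : ℝ}
    (hd : HasDerivWithinAt (fun τ => supp (K τ) y) d (Ico 0 T) t) :
    HasDerivWithinAt (fun τ => supp (polarBody (K τ)) z) (-d) (Ico 0 T) t := by
  obtain ⟨Y, hYs, hY⟩ := exists_contDiffOn_dualityMap_eq hK h0 hs
  have hu : UniqueDiffWithinAt ℝ (Ico 0 T) t := uniqueDiffOn_Ico 0 T t ht
  have hst : ContDiffOn ℝ ∞ (supp (K t)) {0}ᶜ := contDiffOn_slice ht hs
  have hYz : Y (z, t) = y := dualityMap_injective (hK t ht) (h0 t ht) hst (hY (z, t) ⟨hz, ht⟩).1 hy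
    ((hY (z, t) ⟨hz, ht⟩).2.trans hyz.symm)
  have hpos := supp_pos (hK t ht).isCompact (h0 t ht) hy
  have hdy : DifferentiableAt ℝ (supp (K t)) y :=
    (contDiffAt_of_ne_zero hst hy).differentiableAt (by simp)
  set h : E n × ℝ → ℝ := fun p => supp (K p.2) p.1 with hh
  set S : Set (E n × ℝ) := {0}ᶜ ×ˢ Ico 0 T with hS
  set g : ℝ → ℝ := fun τ => supp (polarBody (K τ)) z with hg
  have hgY : ∀ τ ∈ Ico 0 T, g τ = supp (K τ) (Y (z, τ)) := fun τ hτ =>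
    supp_polarBody_eq (hK τ hτ).isCompact (h0 τ hτ) (contDiffOn_slice hτ hs)
      (hY (z, τ) ⟨hz, hτ⟩).1 (hY (z, τ) ⟨hz, hτ⟩).2
  have hgt : g t = supp (K t) y := by rw [hgY t ht, hYz]
  have hcurve : HasDerivWithinAt (fun τ : ℝ => (z, τ)) (0, 1) (Ico 0 T) t :=
    (hasDerivWithinAt_const t _ z).prodMk (hasDerivWithinAt_id t _)
  obtain ⟨y', hy'⟩ : ∃ y', HasDerivWithinAt (fun τ => Y (z, τ)) y' (Ico 0 T) t :=
    ⟨_, ((hYs.differentiableOn (by simp) (z, t) ⟨hz, ht⟩).hasFDerivWithinAt).comp_hasDerivWithinAt t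
      hcurve fun τ hτ => ⟨hz, hτ⟩⟩
  have hD : HasFDerivWithinAt h (fderivWithin ℝ h S (y, t)) S (y, t) :=
    (hs.differentiableOn (by simp) (y, t) ⟨hy, ht⟩).hasFDerivWithinAt
  set L := fderivWithin ℝ h S (y, t) with hL
  have hLt : L (0, 1) = d := by
    have h1 : HasDerivWithinAt (fun τ : ℝ => (y, τ)) (0, 1) (Ico 0 T) t :=
      (hasDerivWithinAt_const t _ y).prodMk (hasDerivWithinAt_id t _)
    exact hu.eq_deriv _ (hD.comp_hasDerivWithinAt t h1 fun τ hτ => ⟨hy, hτ⟩) hd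
  have hLx : L (y', 0) = ⟪gradient (supp (K t)) y, y'⟫ := by
    have h1 : HasFDerivAt (supp (K t)) _ y := hasFDerivAt_slice hy ht hD
    rw [inner_gradient_left, h1.fderiv]
    simp
  have hg' : HasDerivWithinAt g (L (y', 1)) (Ico 0 T) t := by
    have h1 : HasDerivWithinAt (fun τ : ℝ => (Y (z, τ), τ)) (y', 1) (Ico 0 T) t :=
      hy'.prodMk (hasDerivWithinAt_id t _)
    have h2 : HasFDerivWithinAt h L S (Y (z, t), t) := by rwa [hYz]
    exact (h2.comp_hasDerivWithinAt (f := fun τ => (Y (z, τ), τ)) t h1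
      fun τ hτ => ⟨(hY (z, τ) ⟨hz, hτ⟩).1, hτ⟩).congr hgY (hgY t ht)
  have hsplit : L (y', 1) = L (y', 0) + L (0, 1) := by rw [← map_add]; simp
  -- A second relation for the unknown a = ⟪∇s(y), y'⟫. The chain rule gives g' = a + d, while g² =
  -- ⟪z, Y⟫ and z = g ∇s(y) give 2 g g' = g a. Hence a = -2d and g' = -d.
  have hsq : HasDerivWithinAt (fun τ => g τ ^ 2) ⟪z, y'⟫ (Ico 0 T) t := by
    have h1 : HasDerivWithinAt (fun τ => ⟪z, Y (z, τ)⟫) ⟪z, y'⟫ (Ico 0 T) t := by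
      simpa using (hasDerivWithinAt_const t (Ico 0 T) z).inner ℝ hy'
    have h2 : ∀ τ ∈ Ico 0 T, g τ ^ 2 = ⟪z, Y (z, τ)⟫ := fun τ hτ => by
      have hτz := hY (z, τ) ⟨hz, hτ⟩
      have hdτ : DifferentiableAt ℝ (supp (K τ)) (Y (z, τ)) :=
        (contDiffAt_of_ne_zero (contDiffOn_slice hτ hs) hτz.1).differentiableAt (by simp)
      have := inner_dualityMap_self hdτ
      rw [hτz.2] at this
      rw [hgY τ hτ, this]
    exact h1.congr h2 (h2 t ht)
  have hsq' := hu.eq_deriv _ hsq (hg'.pow 2)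
  have hzy' : ⟪z, y'⟫ = g t * L (y', 0) := by
    rw [← hyz, dualityMap, real_inner_smul_left, hLx, hgt]
  rw [hzy', hsplit, hLt] at hsq'
  have hgpos : g t ≠ 0 := by rw [hgt]; exact hpos.ne'
  have hfin : L (y', 0) = -2 * d := by
    have : g t * (L (y', 0) + 2 * d) = 0 := by
      norm_num at hsq'
      linarith
    linarith [(mul_eq_zero.1 this).resolve_left hgpos]
  rw [hsplit, hLt, hfin] at hg'
  convert hg' using 1
  ring

/-- The curvature functions `σ_{n-1}` of a body and of its polar body at dual points. -/
theorem sigma_mul_sigma_polarBody {L : Set (E n)} (hL : IsSmoothStrictlyConvexBody L)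
    (h0 : 0 ∈ interior L) (hs : ContDiffOn ℝ ∞ (supp L) {0}ᶜ)
    (hs' : ContDiffOn ℝ ∞ (supp (polarBody L)) {0}ᶜ) {y z : E n} (hy : y ≠ 0) (hz : ‖z‖ = 1)
    (hyz : dualityMap L y = z) :
    ((supp L y / ‖y‖) ^ (n + 1) * sigma (supp L) (‖y‖⁻¹ • y)) *
      (supp L y ^ (n + 1) * sigma (supp (polarBody L)) z) = 1 := by
  have hz0 : z ≠ 0 := by rintro rfl; simp at hz
  have hyn : 0 < ‖y‖ := norm_pos_iff.2 hy
  have hpos := supp_pos hL.isCompact h0 hy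
  have hsx : supp L (‖y‖⁻¹ • y) = supp L y / ‖y‖ := by
    rw [supp_smul L (inv_nonneg.2 hyn.le), inv_mul_eq_div]
  have hsz := supp_polarBody_eq hL.isCompact h0 hs hy hyz
  have h1 := det_fderiv_smul_gradient (F := supp L) (z := ‖y‖⁻¹ • y)
    (fun c hc x => supp_smul L hc.le x) hs (norm_smul_inv_norm (𝕜 := ℝ) hy)
    (by rw [hsx]; positivity)
  have h2 := det_fderiv_smul_gradient (F := supp (polarBody L)) (z := z)
    (fun c hc x => supp_smul _ hc.le x) hs' hz (by rw [hsz]; exact hpos.ne')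
  have h3 := det_fderiv_dualityMap_mul hL h0 hs hs' hy hz0 hyz
  -- The Jacobian is 0-homogeneous, so it may be evaluated at the unit vector y/|y|, where it is
  -- expressed by σ.
  rw [← fderiv_dualityMap_smul L (inv_pos.2 hyn) y] at h3
  rw [hsx] at h1
  rw [hsz] at h2
  rw [← h1, ← h2]
  exact h3

/-- By Pythagoras the left side is the squared Euclidean norm of ∇s*(z), which is the supporting
point y/s(y) of the polar body. -/
theorem norm_sq_sphGrad_supp_polarBody {L : Set (E n)} (hL : IsSmoothStrictlyConvexBody L)
    (h0 : 0 ∈ interior L) (hs : ContDiffOn ℝ ∞ (supp L) {0}ᶜ)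
    (hs' : ContDiffOn ℝ ∞ (supp (polarBody L)) {0}ᶜ) {y z : E n} (hy : y ≠ 0) (hz : ‖z‖ = 1)
    (hyz : dualityMap L y = z) :
    supp (polarBody L) z ^ 2 + ‖sphGrad (supp (polarBody L)) z‖ ^ 2 = (‖y‖ / supp L y) ^ 2 := by
  have hz0 : z ≠ 0 := by rintro rfl; simp at hz
  have hpos := supp_pos hL.isCompact h0 hy
  have hd : DifferentiableAt ℝ (supp L) y :=
    (contDiffAt_of_ne_zero hs hy).differentiableAt (by simp)
  have hd' : DifferentiableAt ℝ (supp (polarBody L)) z :=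
    (contDiffAt_of_ne_zero hs' hz0).differentiableAt (by simp)
  have hhom : ∀ c : ℝ, 0 < c → ∀ x, supp (polarBody L) (c • x) = c * supp (polarBody L) x :=
    fun c hc x => supp_smul _ hc.le x
  have hw : ‖gradient (supp (polarBody L)) z‖ = ‖y‖ / supp L y := by
    have := gradient_supp_polarBody_dualityMap hL.isCompact h0 hy hd (by rwa [hyz])
    rw [hyz] at this
    rw [this, norm_smul, Real.norm_of_nonneg (inv_nonneg.2 hpos.le), inv_mul_eq_div]
  rw [sphGrad_of_homogeneous hhom hd' hz, norm_sub_sq_real, real_inner_smul_right,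
    inner_gradient_self_of_homogeneous hhom hd', hw, norm_smul, hz, mul_one, Real.norm_eq_abs,
    sq_abs]
  ring

end Evolution

end GaussFlow

end

/-! ### The flow of the polar bodies -/

theorem mainTheorem2 (n : ℕ) (T : ℝ) (K : ℝ → Set (GaussFlow.E n))
    (hK : GaussFlow.EvolvesBy (fun s z => -(1 / GaussFlow.sigma s z)) T K) :
    GaussFlow.EvolvesBy
      (fun s z => s z ^ (n + 2) * GaussFlow.sigma s z /
        (s z ^ 2 + ‖GaussFlow.sphGrad s z‖ ^ 2) ^ ((n : ℝ) / 2))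
      T (fun t => GaussFlow.polarBody (K t)) := by
  have hs := GaussFlow.contDiffOn_supp_iff.1 hK.smooth
  have hs' := GaussFlow.contDiffOn_supp_polarBody hK.body hK.zero_mem hs
  refine ⟨fun t ht => ?_, fun t ht => ?_, ?_, fun t ht z hz => ?_⟩
  · exact GaussFlow.isSmoothStrictlyConvexBody_polarBody (hK.body t ht) (hK.zero_mem t ht)
      (GaussFlow.contDiffOn_slice ht hs)
  · exact GaussFlow.zero_mem_interior_polarBody (hK.body t ht).isCompact
  · exact (GaussFlow.contDiffOn_supp_iff (K := fun t => GaussFlow.polarBody (K t))).2 hs'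
  have hst : ContDiffOn ℝ ∞ (GaussFlow.supp (K t)) {0}ᶜ := GaussFlow.contDiffOn_slice ht hs
  have hst' : ContDiffOn ℝ ∞ (GaussFlow.supp (GaussFlow.polarBody (K t))) {0}ᶜ :=
    GaussFlow.contDiffOn_slice ht hs'
  have hbody := hK.body t ht
  have h0 := hK.zero_mem t ht
  rw [mem_sphere_zero_iff_norm] at hz
  have hz0 : z ≠ 0 := by rintro rfl; simp at hz
  obtain ⟨y, hy, hyz⟩ := GaussFlow.exists_dualityMap_eq hbody h0 hst hz0
  have hyn : 0 < ‖y‖ := norm_pos_iff.2 hy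
  have hpos := GaussFlow.supp_pos hbody.isCompact h0 hy
  have hσ := GaussFlow.sigma_mul_sigma_polarBody hbody h0 hst hst' hy hz hyz
  have hx : ‖y‖⁻¹ • y ∈ Metric.sphere (0 : GaussFlow.E n) 1 := by
    rw [mem_sphere_zero_iff_norm]; exact norm_smul_inv_norm (𝕜 := ℝ) hy
  -- The flow equation is given on the unit sphere only; homogeneity carries it to the dual point
  -- `y` at the cost of the factor |y|.
  have hd : HasDerivWithinAt (fun τ => GaussFlow.supp (K τ) y)
      (‖y‖ * -(1 / GaussFlow.sigma (GaussFlow.supp (K t)) (‖y‖⁻¹ • y))) (Set.Ico 0 T) t := by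
    refine ((hK.evolution t ht _ hx).const_mul ‖y‖).congr_of_mem (fun τ _ => ?_) ht
    rw [GaussFlow.supp_smul _ (inv_nonneg.2 hyn.le), mul_inv_cancel_left₀ hyn.ne']
  convert GaussFlow.hasDerivWithinAt_supp_polarBody hK.body hK.zero_mem hs ht hy hz0 hyz hd using 1
  have hpow : ((‖y‖ / GaussFlow.supp (K t) y) ^ 2) ^ ((n : ℝ) / 2) =
      (‖y‖ / GaussFlow.supp (K t) y) ^ n := by
    rw [← Real.rpow_natCast _ 2, ← Real.rpow_mul (by positivity), ← Real.rpow_natCast _ n]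
    congr 1
    push_cast
    ring
  rw [GaussFlow.norm_sq_sphGrad_supp_polarBody hbody h0 hst hst' hy hz hyz, hpow,
    GaussFlow.supp_polarBody_eq hbody.isCompact h0 hst hy hyz]
  generalize GaussFlow.sigma (GaussFlow.supp (K t)) (‖y‖⁻¹ • y) = σ at hσ ⊢
  generalize GaussFlow.sigma (GaussFlow.supp (GaussFlow.polarBody (K t))) z = σ' at hσ ⊢
  generalize GaussFlow.supp (K t) y = h at hσ hpos ⊢
  -- Nonvanishing of the curvature comes from the product formula itself.
  have hσ0 : σ ≠ 0 := by rintro rfl; simp at hσ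
  rw [mul_neg, neg_neg, mul_one_div, eq_div_iff hσ0]
  calc h ^ (n + 2) * σ' / (‖y‖ / h) ^ n * σ
      = ‖y‖ * ((h / ‖y‖) ^ (n + 1) * σ * (h ^ (n + 1) * σ')) := by
        rw [div_pow, div_pow]
        field_simp
        ring
    _ = ‖y‖ := by rw [hσ, mul_one]
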